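/- **Conventions.** A *QPT algorithm* is a family $(A_n)_{n}$ of quantum circuits, one for each security parameter $n$, over the gate set $\{X,H,T,T^\dagger,\mathrm{CNOT},\mathrm{Toffoli}\}$, of size (wires, gates and outputs) at most $p(n)$ for some polynomial $p$. A circuit starts with its input on the input wires and $0$ on the ancilla wires; at the end its wires are measured in the computational basis. A function $\varepsilon$ is *negligible* if $n^c\,\varepsilon(n)\to 0$ for every $c\in\mathbb N$. Let $\{f_k:\{0,1\}^n\to\{0,1\}^{m(n)}\}_k$ be a family of functions whose index $k$ (a bit string whose length depends on $n$) is drawn from a distribution $\mathrm{Gen}(1^n)$. (For a trapdoor family, $k$ is the public index output by the generator; the trapdoor is not needed for the statement.) Assume: * *two-regularity*: for $n\ge 1$ and every $k$ in the support of $\mathrm{Gen}(1^n)$, every $y\in\operatorname{Im} f_k$ has exactly two preimages; * *second-preimage resistance against quantum adversaries*: some QPT algorithm computes $f_k(x)$ from $(k,x)$ with probability $1$, for all $n\ge1$, all $k$ in the support of $\mathrm{Gen}(1^n)$ and all $x\in\{0,1\}^n$; and for every QPT algorithm $A$ the probability $$\Pr_{k\leftarrow \mathrm{Gen}(1^n),\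 x\leftarrow\{0,1\}^n}\big[A(k,x)=x' \text{ with } x'\neq x \text{ and } f_k(x')=f_k(x)\big]$$ is negligible. For $x,x'\in\{0,1\}^n$, $\alpha=(\alpha_1,\dots,\alpha_{n-1})$ with $\alpha_i\in\{0,\dots,7\}$ (three bits each) and $b\in\{0,1\}^{n-1}$, let $\theta(x,x',\alpha,b)\in\{0,1\}^3$ be the binary expansion of $$\sum_{i=1}^{n-1}(x_i-x'_i)(4b_i+\alpha_i)\bmod 8 .$$ **Theorem.** $\theta$ is a hard-core function for $f_k$, that is: 1. some QPT algorithm computes $\theta(x,x',\alpha,b)$ from $(x,x',\alpha,b)$ with probability $1$, for all inputs; 2. for every way of listing the two preimages of $f_k(x)$ as an ordered pair $(x_1,x_2)$ (for instance $x_1=x$ and $x_2$ the other preimage, or an order that depends on $f_k(x)$ only), and for every QPT algorithm $A$ with one output bit, $$\Big|\Pr\big[A\big(k,f_k(x),\alpha,b,\theta(x_1,x_2,\alpha,b)\big)=1\big]-\Pr\big[A\big(k,f_k(x),\alpha,b,r\big)=1\big]\Big|$$ is negligible, where $k\leftarrow\mathrm{Gen}(1^n)$, and $x\in\{0,1\}^n$,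 $\alpha$, $b$ and $r\in\{0,1\}^3$ are uniform and independent. -/

import Mathlib

namespace QFactory

/-! ## Quantum circuits -/

/-- A gate acting on wires labelled by `W`; the set `{H, T, CNOT}` is universal and the other gates
are included for convenience. -/
inductive Gate (W : Type) : Type
  | X (t : W) : Gate W
  | H (t : W) : Gate W
  | T (t : W) : Gate W
  | Tdg (t : W) : Gate W
  | CNOT (c t : W) (hct : c ≠ t) : Gate W
  | Toffoli (c₁ c₂ t : W) (hcc : c₁ ≠ c₂) (h₁ : c₁ ≠ t) (h₂ : c₂ ≠ t) : Gate W

/-- State vectors (not necessarily normalized) on the qubits labelled by `W`: the amplitude of each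
computational basis vector. -/
abbrev State (W : Type) : Type := (W → Bool) → ℂ

/-- The action of a gate on a state vector. -/
noncomputable def Gate.apply {W : Type} [DecidableEq W] : Gate W → State W → State W
  | .X t, ψ => fun v => ψ (Function.update v t (!(v t)))
  | .H t, ψ => fun v =>
      (ψ (Function.update v t false) + (if v t then -1 else 1) * ψ (Function.update v t true))
        / (Real.sqrt 2 : ℂ)
  | .T t, ψ => fun v => (if v t then Complex.exp (Real.pi / 4 * Complex.I) else 1) * ψ v
  | .Tdg t, ψ => fun v => (if v t then Complex.exp (-(Real.pi / 4 * Complex.I)) else 1) * ψ v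
  | .CNOT c t _, ψ => fun v => ψ (Function.update v t (xor (v t) (v c)))
  | .Toffoli c₁ c₂ t _ _ _, ψ => fun v => ψ (Function.update v t (xor (v t) (v c₁ && v c₂)))

/-- A quantum circuit with input bits labelled by `I` and output bits labelled by `O`. Its wires are
the input wires and `anc` ancilla wires. The gates are applied in the order of the list; afterwards
all wires are measured in the computational basis and the output bit `o` is read off wire `out o`.
(Random coins are obtained from `H` gates on ancillas.) -/
structure Circuit (I O : Type) : Type where
  anc : ℕ
  gates : List (Gate (I ⊕ Fin anc))
  out : O → I ⊕ Fin anc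

namespace Circuit

variable {I O : Type}

/-- The size of a circuit: wires, gates and outputs. -/
def size [Fintype I] [Fintype O] (C : Circuit I O) : ℕ :=
  Fintype.card I + C.anc + C.gates.length + Fintype.card O

/-- The basis state in which the circuit starts: the input, and zeros on the ancillas. -/
noncomputable def init [Fintype I] (C : Circuit I O) (x : I → Bool) : State (I ⊕ Fin C.anc) :=
  fun v => if v = Sum.elim x (fun _ => false) then 1 else 0

/-- The state before the measurement. -/
noncomputable def final [Fintype I] [DecidableEq I] (C : Circuit I O) (x : I → Bool) :
    State (I ⊕ Fin C.anc) :=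
  C.gates.foldl (fun ψ g => g.apply ψ) (C.init x)

/-- The probability that the circuit outputs `y` on input `x`. -/
noncomputable def prob [Fintype I] [DecidableEq I] [Fintype O] (C : Circuit I O)
    (x : I → Bool) (y : O → Bool) : ℝ :=
  ∑ v : I ⊕ Fin C.anc → Bool, if (fun o => v (C.out o)) = y then ‖C.final x v‖ ^ 2 else 0

end Circuit

/-- A quantum polynomial-time algorithm: a family of polynomially-sized quantum circuits. -/
def IsQPT {I O : ℕ → Type} [∀ n, Fintype (I n)] [∀ n, Fintype (O n)]
    (A : ∀ n, Circuit (I n) (O n)) : Prop :=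
  ∃ p : Polynomial ℕ, ∀ n, (A n).size ≤ p.eval n

/-- Negligible functions: `n ^ c * ε n → 0` for every `c`. -/
def Negligible (ε : ℕ → ℝ) : Prop :=
  Asymptotics.SuperpolynomialDecay Filter.atTop (fun n : ℕ => (n : ℝ)) ε

/-- The average over a uniformly random element. -/
noncomputable def avg {α : Type} [Fintype α] (φ : α → ℝ) : ℝ :=
  (∑ a, φ a) / Fintype.card α

/-! ## Families of functions -/

/-- Bit strings of length `n`. -/
abbrev BitString (n : ℕ) : Type := Fin n → Bool

/-- A keyed family of functions `f_k : {0,1}^n → {0,1}^{m(n)}`, where the index `k`, a bit string, is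
drawn from the distribution `gen n` for the security parameter `n`. -/
structure FunctionFamily : Type where
  keyLen : ℕ → ℕ
  outLen : ℕ → ℕ
  gen : ∀ n, PMF (BitString (keyLen n))
  f : ∀ n, BitString (keyLen n) → BitString n → BitString (outLen n)

namespace FunctionFamily

/-- The expectation over a random index `k`. -/
noncomputable def expectKey (F : FunctionFamily) (n : ℕ) (φ : BitString (F.keyLen n) → ℝ) : ℝ :=
  ∑ k, (F.gen n k).toReal * φ k

/-- Every element of the image of every `f_k` has exactly two preimages. -/
def TwoRegular (F : FunctionFamily) : Prop :=
  ∀ n, 1 ≤ n → ∀ k ∈ (F.gen n).support, ∀ y ∈ Set.range (F.f n k), (F.f n k ⁻¹' {y}).ncard = 2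

/-- There is a QPT algorithm which computes `f_k(x)` from `(k, x)`, for all indices `k` that can
occur and all `x`. -/
def EfficientlyComputable (F : FunctionFamily) : Prop :=
  ∃ C : ∀ n, Circuit (Fin (F.keyLen n) ⊕ Fin n) (Fin (F.outLen n)),
    IsQPT C ∧
    ∀ n, 1 ≤ n → ∀ k ∈ (F.gen n).support, ∀ x : BitString n,
      (C n).prob (Sum.elim k x) (F.f n k x) = 1

/-- The probability, over the index `k`, a uniform `x` and the randomness of `A`, that `A` on input
`(k, x)` outputs a second preimage. -/
noncomputable def secondPreimageProb (F : FunctionFamily) (n : ℕ)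
    (A : Circuit (Fin (F.keyLen n) ⊕ Fin n) (Fin n)) : ℝ :=
  F.expectKey n fun k => avg fun x : BitString n =>
    ∑ x' : BitString n,
      if x' ≠ x ∧ F.f n k x' = F.f n k x then A.prob (Sum.elim k x) x' else 0

/-- Second-preimage resistance against quantum adversaries. -/
def SecondPreimageResistant (F : FunctionFamily) : Prop :=
  F.EfficientlyComputable ∧
  ∀ A : ∀ n, Circuit (Fin (F.keyLen n) ⊕ Fin n) (Fin n),
    IsQPT A → Negligible fun n => F.secondPreimageProb n (A n)

/-- `pre n k x` lists, in some order, two different preimages of `f_k(x)`. The order may depend on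
`x` (as in `(x, x')` where `x` is the sampled input) or on the image only. -/
def IsPreimagePair (F : FunctionFamily)
    (pre : ∀ n, BitString (F.keyLen n) → BitString n → BitString n × BitString n) : Prop :=
  ∀ n, 1 ≤ n → ∀ k ∈ (F.gen n).support, ∀ x : BitString n,
    (pre n k x).1 ≠ (pre n k x).2 ∧
    F.f n k (pre n k x).1 = F.f n k x ∧ F.f n k (pre n k x).2 = F.f n k x

/-- The probability that the distinguisher `A` outputs `1` on `(k, f_k(x), β, g(x₁, x₂, β))`, where
`(x₁, x₂)` are the preimages of `f_k(x)`, and `x`, `β` are uniform. -/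
noncomputable def realProb (F : FunctionFamily) {B : Type} [Fintype B] [DecidableEq B] {ℓ : ℕ}
    (n : ℕ) (g : BitString n → BitString n → (B → Bool) → BitString ℓ)
    (pre : BitString (F.keyLen n) → BitString n → BitString n × BitString n)
    (A : Circuit (Fin (F.keyLen n) ⊕ Fin (F.outLen n) ⊕ B ⊕ Fin ℓ) (Fin 1)) : ℝ :=
  F.expectKey n fun k => avg fun x : BitString n => avg fun β : B → Bool =>
    A.prob (Sum.elim k (Sum.elim (F.f n k x) (Sum.elim β (g (pre k x).1 (pre k x).2 β))))
      (fun _ => true)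

/-- The probability that the distinguisher `A` outputs `1` on `(k, f_k(x), β, r)` with `x`, `β`, `r`
uniform and independent. -/
noncomputable def randomProb (F : FunctionFamily) {B : Type} [Fintype B] [DecidableEq B] {ℓ : ℕ}
    (n : ℕ) (A : Circuit (Fin (F.keyLen n) ⊕ Fin (F.outLen n) ⊕ B ⊕ Fin ℓ) (Fin 1)) : ℝ :=
  F.expectKey n fun k => avg fun x : BitString n => avg fun β : B → Bool =>
    avg fun r : BitString ℓ =>
      A.prob (Sum.elim k (Sum.elim (F.f n k x) (Sum.elim β r))) (fun _ => true)

/-- `g(x, x', β)`, restricted to pairs of different preimages `x, x'` of the same point, is a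
hard-core function for the two-regular functions `f_k`: it is computable by a QPT algorithm, and no
QPT distinguisher which is given `k`, the image `f_k(x)` and `β` can tell its value from a uniform
`ℓ`-bit string. -/
def IsHardcore (F : FunctionFamily) {B : ℕ → Type} [∀ n, Fintype (B n)] [∀ n, DecidableEq (B n)]
    {ℓ : ℕ} (g : ∀ n, BitString n → BitString n → (B n → Bool) → BitString ℓ) : Prop :=
  (∃ C : ∀ n, Circuit (Fin n ⊕ Fin n ⊕ B n) (Fin ℓ),
    IsQPT C ∧
    ∀ n, ∀ x x' : BitString n, ∀ β : B n → Bool,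
      (C n).prob (Sum.elim x (Sum.elim x' β)) (g n x x' β) = 1) ∧
  ∀ pre, F.IsPreimagePair pre →
    ∀ A : ∀ n, Circuit (Fin (F.keyLen n) ⊕ Fin (F.outLen n) ⊕ B n ⊕ Fin ℓ) (Fin 1),
      IsQPT A →
        Negligible fun n => |F.realProb n (g n) (pre n) (A n) - F.randomProb n (A n)|

end FunctionFamily

/-! ## The function -/

/-- The residue modulo 8 written by three bits, most significant bit first. -/
def ofThreeBits (a : BitString 3) : ZMod 8 :=
  4 * ((a 0).toNat : ZMod 8) + 2 * ((a 1).toNat : ZMod 8) + ((a 2).toNat : ZMod 8)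

/-- The three bits of a residue modulo 8, most significant bit first. -/
def toThreeBits (t : ZMod 8) : BitString 3 := fun j => t.val.testBit (2 - j.val)

theorem ofThreeBits_toThreeBits (t : ZMod 8) : ofThreeBits (toThreeBits t) = t := by
  revert t; decide

/-- The bits of `β = (α, b)`: three bits for each `α_i` and one bit for each `b_i`, where `i` runs
over the first `n - 1` positions. -/
abbrev AngleBits (n : ℕ) : Type := (Fin (n - 1) × Fin 3) ⊕ Fin (n - 1)

/-- `∑_{i < n} (x_i - x'_i) (4 b_i + α_i)` modulo 8. -/
def thetaZMod (n : ℕ) (x x' : BitString n) (α : Fin (n - 1) → BitString 3)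
    (b : Fin (n - 1) → Bool) : ZMod 8 :=
  ∑ i : Fin (n - 1),
    (((x (Fin.castLE (Nat.sub_le n 1) i)).toNat : ZMod 8)
      - ((x' (Fin.castLE (Nat.sub_le n 1) i)).toNat : ZMod 8))
    * (4 * ((b i).toNat : ZMod 8) + ofThreeBits (α i))

/-- The three-bit value `θ`, as a function of `x`, `x'` and `β = (α, b)`. -/
def theta (n : ℕ) (x x' : BitString n) (β : AngleBits n → Bool) : BitString 3 :=
  toThreeBits (thetaZMod n x x' (fun i j => β (Sum.inl (i, j))) (fun i => β (Sum.inr i)))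

end QFactory

/-! The hard-core property is a quantum Goldreich-Levin argument. Fix `k`, `x` and the two
preimages, and let D(β, t) be the output bias of the distinguisher. Expand D(β, ·) in the characters
(-1)^(τ·t) of {0,1}^3. The trivial character accounts exactly for a uniform `r`, so the advantage is
the sum over τ ≠ 0 of the averages over β of (-1)^(τ·θ(β)) times the coefficient of D(β, ·) at τ.

For τ ≠ 0 let v be its most significant nonzero position, and let w consist of the bits in position
v of all α_i. They enter θ through the term 2^(2-v) Σ (x_i - x'_i) w_i modulo 8. This term leaves
the bits below v alone, changes bit v by its parity, and disturbs by carries only the bits above v,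
which τ ignores. Hence (-1)^(τ·θ) is, up to a sign independent of w, the linear character
(-1)^(s·w), where s is x ⊕ x' on the first n-1 positions (`dotSign_theta_extend`). By Cauchy-Schwarz
the squared advantage is bounded by mean squares of correlations of D with such characters
(`sq_advantage_le`).

A single quantum query realizes these mean squares as probabilities: take β and t in uniform
superposition, run the distinguisher, flip the phase on output 1, uncompute, and apply Hadamard
gates to w and t. The amplitude of the outcome (s, τ) with clean work space is proportional to the
correlation (`run_queryGates`, `le_prob_extraction`). Adding s to x gives the other preimage except
for its last bit, which θ does not involve and which a coin guesses (`le_prob_imageFinder`). The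
image needed by the query is computed beforehand (`prob_le_prob_compCircuit`). As s is symmetric,
the order of the preimages is irrelevant.

Together, the squared advantage is at most four times the total success probability of three
finders, one for each v (`sq_realProb_sub_randomProb_le`), and is therefore negligible.
Computability of θ comes from a reversible adder modulo 8 (`thetaCircuit_prob`). -/

namespace QFactory

/-! ## Semantics of gate lists -/

section Semantics

variable {W W' : Type} [DecidableEq W] [DecidableEq W']

/-- The action of a list of gates, applied from left to right. -/
noncomputable def run (gs : List (Gate W)) (ψ : State W) : State W :=
  gs.foldl (fun ψ g => g.apply ψ) ψ

@[simp] theorem run_nil (ψ : State W) : run [] ψ = ψ := rfl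

@[simp] theorem run_cons (g : Gate W) (gs : List (Gate W)) (ψ : State W) :
    run (g :: gs) ψ = run gs (g.apply ψ) := rfl

theorem run_append (gs hs : List (Gate W)) (ψ : State W) :
    run (gs ++ hs) ψ = run hs (run gs ψ) := by
  simp [run, List.foldl_append]

/-- The computational basis vectors. -/
def basis [Fintype W] (u : W → Bool) : State W := fun v => if v = u then 1 else 0

/-- Renaming of wires. -/
def Gate.map (f : W ↪ W') : Gate W → Gate W'
  | .X t => .X (f t)
  | .H t => .H (f t)
  | .T t => .T (f t)
  | .Tdg t => .Tdg (f t)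
  | .CNOT c t h => .CNOT (f c) (f t) (f.injective.ne h)
  | .Toffoli c d t h₁ h₂ h₃ =>
      .Toffoli (f c) (f d) (f t) (f.injective.ne h₁) (f.injective.ne h₂) (f.injective.ne h₃)

theorem extend_update_comp (f : W ↪ W') (v : W' → Bool) (t : W) (b : Bool) :
    Function.extend f (Function.update (v ∘ f) t b) v = Function.update v (f t) b := by
  funext w
  by_cases hw : ∃ a, f a = w
  · obtain ⟨a, rfl⟩ := hw
    rw [f.injective.extend_apply]
    by_cases hat : a = t
    · subst hat; simp
    · rw [Function.update_of_ne hat, Function.update_of_ne (f.injective.ne hat)]; rfl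
  · rw [Function.extend_apply' _ _ _ hw, Function.update_of_ne]
    rintro rfl
    exact hw ⟨t, rfl⟩

omit [DecidableEq W] [DecidableEq W'] in
theorem extend_extend (f : W ↪ W') (u u' : W → Bool) (v : W' → Bool) :
    Function.extend f u (Function.extend f u' v) = Function.extend f u v := by
  funext w
  by_cases hw : ∃ a, f a = w
  · obtain ⟨a, rfl⟩ := hw
    rw [f.injective.extend_apply, f.injective.extend_apply]
  · rw [Function.extend_apply' _ _ _ hw, Function.extend_apply' _ _ _ hw,
      Function.extend_apply' _ _ _ hw]

omit [DecidableEq W] [DecidableEq W'] in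
theorem extend_self_comp (f : W ↪ W') (v : W' → Bool) : Function.extend f (v ∘ f) v = v := by
  funext w
  by_cases hw : ∃ a, f a = w
  · obtain ⟨a, rfl⟩ := hw
    rw [f.injective.extend_apply]; rfl
  · rw [Function.extend_apply' _ _ _ hw]

/-- A renamed gate acts on each slice of the state vector. -/
theorem Gate.apply_map (f : W ↪ W') (g : Gate W) (ψ : State W') (v : W' → Bool) :
    (g.map f).apply ψ v = g.apply (fun w => ψ (Function.extend f w v)) (v ∘ f) := by
  cases g <;>
    simp only [Gate.map, Gate.apply, extend_update_comp, extend_self_comp, Function.comp_apply]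

/-- Wires outside the range of `f` are never touched, so their values in `v` act as parameters: the
circuit evolves each slice of the state separately. Every later composition of subcircuits is
computed slice by slice in this way. -/
theorem run_map (f : W ↪ W') (gs : List (Gate W)) (ψ : State W') (v : W' → Bool) :
    run (gs.map (Gate.map f)) ψ v = run gs (fun w => ψ (Function.extend f w v)) (v ∘ f) := by
  induction gs generalizing ψ with
  | nil => simp [extend_self_comp]
  | cons g gs ih =>
    rw [List.map_cons, run_cons, ih, run_cons]
    congr 1
    funext w
    rw [Gate.apply_map]
    simp only [extend_extend]
    congr 1
    exact Function.extend_comp f.injective w v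

theorem Gate.apply_smul (g : Gate W) (c : ℂ) (ψ : State W) :
    g.apply (fun v => c * ψ v) = fun v => c * g.apply ψ v := by
  cases g <;> funext v <;> simp only [Gate.apply] <;> ring

theorem run_smul (gs : List (Gate W)) (c : ℂ) (ψ : State W) :
    run gs (fun v => c * ψ v) = fun v => c * run gs ψ v := by
  induction gs generalizing ψ with
  | nil => rfl
  | cons g gs ih => rw [run_cons, Gate.apply_smul, ih, run_cons]

end Semantics

/-! ## Adjoints and unitarity -/

section Unitarity

variable {W : Type} [DecidableEq W]

/-- The inverse gate. -/
def Gate.dagger : Gate W → Gate W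
  | .X t => .X t
  | .H t => .H t
  | .T t => .Tdg t
  | .Tdg t => .T t
  | .CNOT c t h => .CNOT c t h
  | .Toffoli c d t h₁ h₂ h₃ => .Toffoli c d t h₁ h₂ h₃

/-- The inverse of a list of gates. -/
def daggers (gs : List (Gate W)) : List (Gate W) := (gs.map Gate.dagger).reverse

/-- The Hadamard gate as `(Z + X) / √2`. -/
theorem Gate.apply_H (t : W) (ψ : State W) (v : W → Bool) :
    (Gate.H t).apply ψ v =
      ((if v t then -1 else 1) * ψ v + ψ (Function.update v t (!(v t)))) / (Real.sqrt 2 : ℂ) := by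
  simp only [Gate.apply]
  cases h : v t
  · rw [← h, Function.update_eq_self, h]; simp
  · conv_lhs => rw [← h, Function.update_eq_self, h]
    simp; ring

/-- Covers `CNOT` and `Toffoli` at once: the bit added to the target does not depend on the target,
so adding it twice cancels. -/
theorem involutive_update (t : W) (φ : (W → Bool) → Bool)
    (hφ : ∀ v b, φ (Function.update v t b) = φ v) :
    Function.Involutive fun v : W → Bool => Function.update v t (xor (v t) (φ v)) := by
  intro v
  simp [hφ]

theorem sqrt_two_mul_self : (Real.sqrt 2 : ℂ) * (Real.sqrt 2 : ℂ) = 2 := by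
  rw [← Complex.ofReal_mul, Real.mul_self_sqrt (by norm_num)]; norm_num

theorem sqrt_two_ne_zero : (Real.sqrt 2 : ℂ) ≠ 0 := by
  simp

theorem exp_mul_exp_neg (a : ℂ) : Complex.exp (-a) * Complex.exp a = 1 := by
  rw [← Complex.exp_add]; simp

theorem conj_exp_phase : (starRingEnd ℂ) (Complex.exp (Real.pi / 4 * Complex.I)) =
    Complex.exp (-(Real.pi / 4 * Complex.I)) := by
  rw [← Complex.exp_conj]
  congr 1
  simp [map_ofNat]

omit [DecidableEq W] in
theorem Gate.dagger_dagger (g : Gate W) : g.dagger.dagger = g := by cases g <;> rfl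

theorem Gate.dagger_apply_apply (g : Gate W) (ψ : State W) : g.dagger.apply (g.apply ψ) = ψ := by
  cases g with
  | X t => funext v; simp [Gate.dagger, Gate.apply]
  | H t =>
    funext v
    have h2 := sqrt_two_mul_self
    have h0 := sqrt_two_ne_zero
    simp only [Gate.dagger, Gate.apply_H]
    cases h : v t <;> simp <;> field_simp <;> rw [pow_two, h2]
    · have : Function.update v t false = v := by rw [← h, Function.update_eq_self]
      rw [this]; ring
    · have : Function.update v t true = v := by rw [← h, Function.update_eq_self]
      rw [this]; ring
  | T t =>
    funext v
    simp only [Gate.dagger, Gate.apply, ← mul_assoc]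
    cases v t <;> simp [exp_mul_exp_neg]
  | Tdg t =>
    funext v
    simp only [Gate.dagger, Gate.apply, ← mul_assoc]
    cases v t
    · simp
    · simp only [if_true, mul_comm (Complex.exp (Real.pi / 4 * Complex.I)), exp_mul_exp_neg, one_mul]
  | CNOT c t h => funext v; simp [Gate.dagger, Gate.apply, h]
  | Toffoli c d t h₁ h₂ h₃ => funext v; simp [Gate.dagger, Gate.apply, h₂, h₃]

variable [Fintype W]

theorem sum_conj_mul_comp_involutive {σ : (W → Bool) → W → Bool} (hσ : Function.Involutive σ)
    (φ ψ : State W) :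
    ∑ v, (starRingEnd ℂ) (φ v) * ψ (σ v) = ∑ v, (starRingEnd ℂ) (φ (σ v)) * ψ v :=
  Fintype.sum_equiv hσ.toPerm _ _ fun v => by simp [hσ v]

/-- The permutation gates are self-adjoint as involutions of the basis, the phase gates are diagonal
with conjugate entries, and `H` combines both cases through its form (Z + X) / √2. -/
theorem Gate.adjoint (g : Gate W) (φ ψ : State W) :
    ∑ v, (starRingEnd ℂ) (φ v) * g.apply ψ v = ∑ v, (starRingEnd ℂ) (g.dagger.apply φ v) * ψ v := by
  cases g with
  | X t =>
    exact sum_conj_mul_comp_involutive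
      (σ := fun v => Function.update v t (!(v t))) (fun v => by simp) φ ψ
  | H t =>
    have h := sum_conj_mul_comp_involutive
      (σ := fun v => Function.update v t (!(v t))) (fun v => by simp) φ ψ
    simp only [Gate.dagger, Gate.apply_H]
    have e1 : ∀ v : W → Bool, (starRingEnd ℂ) (φ v) *
        (((if v t then -1 else 1) * ψ v + ψ (Function.update v t (!(v t)))) / (Real.sqrt 2 : ℂ)) =
        ((if v t then -1 else 1) * ((starRingEnd ℂ) (φ v) * ψ v)) / (Real.sqrt 2 : ℂ) +
        ((starRingEnd ℂ) (φ v) * ψ (Function.update v t (!(v t)))) / (Real.sqrt 2 : ℂ) := by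
      intro v; ring
    have e2 : ∀ v : W → Bool, (starRingEnd ℂ)
        (((if v t then -1 else 1) * φ v + φ (Function.update v t (!(v t)))) / (Real.sqrt 2 : ℂ))
          * ψ v =
        ((if v t then -1 else 1) * ((starRingEnd ℂ) (φ v) * ψ v)) / (Real.sqrt 2 : ℂ) +
        ((starRingEnd ℂ) (φ (Function.update v t (!(v t)))) * ψ v) / (Real.sqrt 2 : ℂ) := by
      intro v
      cases v t <;> simp [Complex.conj_ofReal] <;> ring
    simp only [e1, e2, Finset.sum_add_distrib, ← Finset.sum_div, h]
  | T t =>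
    refine Finset.sum_congr rfl fun v _ => ?_
    simp only [Gate.dagger, Gate.apply, map_mul]
    cases v t
    · simp
    · simp only [if_true, ← conj_exp_phase, Complex.conj_conj]; ring
  | Tdg t =>
    refine Finset.sum_congr rfl fun v _ => ?_
    simp only [Gate.dagger, Gate.apply, map_mul]
    cases v t
    · simp
    · simp only [if_true, conj_exp_phase]; ring
  | CNOT c t h =>
    exact sum_conj_mul_comp_involutive
      (involutive_update t (fun v => v c) fun v b => by simp [h]) φ ψ
  | Toffoli c d t h₁ h₂ h₃ =>
    exact sum_conj_mul_comp_involutive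
      (involutive_update t (fun v => v c && v d) fun v b => by simp [h₂, h₃]) φ ψ

theorem run_daggers_adjoint (gs : List (Gate W)) (φ ψ : State W) :
    ∑ v, (starRingEnd ℂ) (φ v) * run (daggers gs) ψ v =
      ∑ v, (starRingEnd ℂ) (run gs φ v) * ψ v := by
  induction gs generalizing φ with
  | nil => rfl
  | cons g gs ih =>
    have : daggers (g :: gs) = daggers gs ++ [g.dagger] := by simp [daggers]
    rw [this, run_append, run_cons, run_nil, Gate.adjoint, Gate.dagger_dagger, ih, run_cons]

theorem Gate.sum_norm_sq_apply (g : Gate W) (ψ : State W) :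
    ∑ v, ‖g.apply ψ v‖ ^ 2 = ∑ v, ‖ψ v‖ ^ 2 := by
  -- Pairing `g.apply ψ` with itself and moving one gate across leaves the pairing of `ψ` with
  -- itself.
  have h := Gate.adjoint g (g.apply ψ) ψ
  rw [Gate.dagger_apply_apply] at h
  simp only [Complex.conj_mul'] at h
  exact_mod_cast h

theorem sum_norm_sq_run (gs : List (Gate W)) (ψ : State W) :
    ∑ v, ‖run gs ψ v‖ ^ 2 = ∑ v, ‖ψ v‖ ^ 2 := by
  induction gs generalizing ψ with
  | nil => rfl
  | cons g gs ih => rw [run_cons, ih, Gate.sum_norm_sq_apply]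

theorem sum_norm_sq_basis (u : W → Bool) : ∑ v, ‖basis u v‖ ^ 2 = 1 := by
  have : ∀ v, ‖basis u v‖ ^ 2 = if v = u then 1 else 0 := by
    intro v; by_cases h : v = u <;> simp [basis, h]
  simp [this]

end Unitarity

/-! ## Hadamard gates on all wires -/

section Hadamard

variable {W : Type} [DecidableEq W] [Fintype W]

/-- The sign `(-1) ^ (a * b)`. -/
def bitSign (a b : Bool) : ℤ := if a && b then -1 else 1

/-- The sign `(-1) ^ ∑ a * b`. -/
def dotSign {S : Type} [Fintype S] (a b : S → Bool) : ℤ := ∏ s, bitSign (a s) (b s)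

/-- The action of a tensor product of `2 × 2` matrices. -/
def tensorApply (K : W → Bool → Bool → ℂ) (ψ : State W) : State W :=
  fun v => ∑ u, (∏ w, K w (v w) (u w)) * ψ u

theorem tensorApply_tensorApply (K L : W → Bool → Bool → ℂ) (ψ : State W) :
    tensorApply K (tensorApply L ψ) =
      tensorApply (fun w a b => ∑ c, K w a c * L w c b) ψ := by
  funext v
  simp only [tensorApply, Finset.mul_sum, Finset.prod_univ_sum, Fintype.piFinset_univ,
    Finset.sum_mul]
  rw [Finset.sum_comm]
  refine Finset.sum_congr rfl fun u _ => Finset.sum_congr rfl fun u' _ => ?_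
  rw [Finset.prod_mul_distrib]; ring

/-- The matrix of a Hadamard gate. -/
noncomputable def hadamardEntry (a b : Bool) : ℂ := (bitSign a b : ℂ) / (Real.sqrt 2 : ℂ)

omit [DecidableEq W] in
theorem prod_delta (v u : W → Bool) :
    ∏ w, (if v w = u w then (1 : ℂ) else 0) = if u = v then 1 else 0 := by
  by_cases h : u = v
  · simp [h]
  · rw [if_neg h]
    obtain ⟨w, hw⟩ := Function.ne_iff.mp h
    exact Finset.prod_eq_zero (Finset.mem_univ w) (if_neg (Ne.symm hw))

theorem tensorApply_delta (ψ : State W) :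
    tensorApply (fun _ a b => if a = b then 1 else 0) ψ = ψ := by
  funext v
  simp [tensorApply, prod_delta]

/-- As a tensor product with identity factors on the other wires, successive Hadamard gates compose
by multiplying 2 × 2 matrices wire by wire. -/
theorem Gate.apply_H_eq_tensorApply (t : W) (ψ : State W) :
    (Gate.H t).apply ψ = tensorApply
      (fun w a b => if w = t then hadamardEntry a b else if a = b then 1 else 0) ψ := by
  funext v
  have key : ∀ u : W → Bool,
      (∏ w, if w = t then hadamardEntry (v w) (u w) else if v w = u w then 1 else 0) * ψ u =
      ∑ b : Bool, if u = Function.update v t b then hadamardEntry (v t) b * ψ u else 0 := by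
    intro u
    -- The product of entries vanishes unless `u` agrees with `v` off wire `t`; only the two values
    -- at `t` remain.
    by_cases h : ∀ w, w ≠ t → v w = u w
    · have hu : u = Function.update v t (u t) := by
        funext w
        by_cases hw : w = t
        · subst hw; simp
        · rw [Function.update_of_ne hw, h w hw]
      rw [Finset.prod_eq_single t]
      · rw [Finset.sum_eq_single (u t)]
        · rw [if_pos hu, if_pos rfl]
        · intro b _ hb
          rw [if_neg]
          intro hub
          apply hb
          have := congrFun hub t
          simpa using this.symm
        · simp
      · intro w _ hw
        rw [if_neg hw, if_pos (h w hw)]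
      · simp
    · push Not at h
      obtain ⟨w, hw, hvw⟩ := h
      rw [Finset.prod_eq_zero (Finset.mem_univ w) (by rw [if_neg hw, if_neg hvw]), zero_mul]
      symm
      refine Finset.sum_eq_zero fun b _ => if_neg ?_
      rintro rfl
      exact hvw (by rw [Function.update_of_ne hw])
  simp only [tensorApply, key]
  rw [Finset.sum_comm]
  simp only [Finset.sum_ite_eq', Finset.mem_univ, if_true, Fintype.sum_bool, Gate.apply,
    hadamardEntry, bitSign]
  cases v t <;> simp <;> ring

theorem run_hadamard_list (l : List W) (hl : l.Nodup) (ψ : State W) :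
    run (l.map Gate.H) ψ = tensorApply
      (fun w a b => if w ∈ l then hadamardEntry a b else if a = b then 1 else 0) ψ := by
  induction l generalizing ψ with
  | nil => simp [tensorApply_delta]
  | cons t l ih =>
    rw [List.nodup_cons] at hl
    rw [List.map_cons, run_cons, ih hl.2, Gate.apply_H_eq_tensorApply, tensorApply_tensorApply]
    congr 1
    funext w a b
    by_cases hwt : w = t
    · subst hwt
      simp [hl.1]
    · simp [hwt]

/-- Hadamard gates on all wires. -/
noncomputable def hadamards (W : Type) [Fintype W] : List (Gate W) :=
  (Finset.univ : Finset W).toList.map Gate.H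

omit [DecidableEq W] in
theorem length_hadamards : (hadamards W).length = Fintype.card W := by
  simp [hadamards]

theorem run_hadamards (ψ : State W) (v : W → Bool) :
    run (hadamards W) ψ v =
      (1 / (Real.sqrt 2 : ℂ)) ^ Fintype.card W * ∑ u, (dotSign v u : ℂ) * ψ u := by
  rw [hadamards, run_hadamard_list _ (Finset.nodup_toList _)]
  simp only [tensorApply, Finset.mem_toList, Finset.mem_univ, if_true, Finset.mul_sum]
  refine Finset.sum_congr rfl fun u _ => ?_
  rw [dotSign]
  push_cast
  simp only [hadamardEntry, Finset.prod_div_distrib, Finset.prod_const, Finset.card_univ]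
  ring

end Hadamard

/-! ## Copying by CNOT gates -/

section Copy

variable {W J : Type} [DecidableEq W] [Fintype J]

/-- CNOT gates from the wires `src j` to the wires `tgt j`. -/
noncomputable def copies (src tgt : J → W) (h : ∀ j j', src j ≠ tgt j') : List (Gate W) :=
  (Finset.univ : Finset J).toList.map fun j => Gate.CNOT (src j) (tgt j) (h j j)

omit [DecidableEq W] in
theorem length_copies (src tgt : J → W) (h : ∀ j j', src j ≠ tgt j') :
    (copies src tgt h).length = Fintype.card J := by
  simp [copies]

-- No source is a target, so the gates do not interfere and the pullback by the whole list can be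
-- written in one formula.
omit [Fintype J] in
theorem run_copy_list [DecidableEq J] (src : J → W) (tgt : J ↪ W) (h : ∀ j j', src j ≠ tgt j')
    (l : List J) (hl : l.Nodup) (ψ : State W) (v : W → Bool) :
    run (l.map fun j => Gate.CNOT (src j) (tgt j) (h j j)) ψ v =
      ψ (Function.extend tgt (fun j => xor (v (tgt j)) (decide (j ∈ l) && v (src j))) v) := by
  induction l generalizing ψ with
  | nil =>
    have := extend_self_comp tgt v
    simpa [Function.comp_def] using congrArg ψ this.symm
  | cons i l ih =>
    rw [List.nodup_cons] at hl
    rw [List.map_cons, run_cons, ih hl.2]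
    refine congrArg ψ ?_
    have hsrc : ∀ (u : J → Bool) (j : J), Function.extend tgt u v (src j) = v (src j) := by
      intro u j
      rw [Function.extend_apply']
      rintro ⟨a, ha⟩
      exact h j a ha.symm
    funext w
    by_cases hw : ∃ a, tgt a = w
    · obtain ⟨a, rfl⟩ := hw
      rw [tgt.injective.extend_apply]
      by_cases hai : a = i
      · subst hai
        rw [Function.update_self, tgt.injective.extend_apply, hsrc]
        simp [hl.1]
      · rw [Function.update_of_ne (tgt.injective.ne hai), tgt.injective.extend_apply,
          tgt.injective.extend_apply]
        simp [hai]
    · rw [Function.extend_apply' _ _ _ hw, Function.update_of_ne, Function.extend_apply' _ _ _ hw]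
      rintro rfl
      exact hw ⟨i, rfl⟩

theorem run_copies (src : J → W) (tgt : J ↪ W) (h : ∀ j j', src j ≠ tgt j')
    (ψ : State W) (v : W → Bool) :
    run (copies src tgt h) ψ v =
      ψ (Function.extend tgt (fun j => xor (v (tgt j)) (v (src j))) v) := by
  classical
  rw [copies, run_copy_list src tgt h _ (Finset.nodup_toList _)]
  simp

end Copy

/-! ## Circuits with an arbitrary type of ancillas -/

namespace Circuit

variable {I O A : Type} [Fintype I] [DecidableEq I] [Fintype O] [Fintype A] [DecidableEq A]

omit [Fintype O] in
theorem final_eq_run (C : Circuit I O) (x : I → Bool) :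
    C.final x = run C.gates (basis (Sum.elim x fun _ => false)) := rfl

theorem prob_nonneg (C : Circuit I O) (x : I → Bool) (y : O → Bool) : 0 ≤ C.prob x y :=
  Finset.sum_nonneg fun v _ => by split_ifs <;> positivity

omit [Fintype O] in
theorem sum_norm_sq_final (C : Circuit I O) (x : I → Bool) : ∑ v, ‖C.final x v‖ ^ 2 = 1 := by
  rw [final_eq_run, sum_norm_sq_run, sum_norm_sq_basis]

/-- The renumbering of the ancillas. -/
noncomputable def ancEquiv (I A : Type) [Fintype A] : I ⊕ A ≃ I ⊕ Fin (Fintype.card A) :=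
  Equiv.sumCongr (Equiv.refl I) (Fintype.equivFin A)

/-- The circuit given by a list of gates on input wires and ancillas labelled by a finite type. -/
noncomputable def ofGates (gates : List (Gate (I ⊕ A))) (out : O → I ⊕ A) : Circuit I O where
  anc := Fintype.card A
  gates := gates.map (Gate.map (ancEquiv I A).toEmbedding)
  out := fun o => ancEquiv I A (out o)

omit [DecidableEq I] [DecidableEq A] in
theorem size_ofGates (gates : List (Gate (I ⊕ A))) (out : O → I ⊕ A) :
    (ofGates gates out).size =
      Fintype.card I + Fintype.card A + gates.length + Fintype.card O := by
  simp [size, ofGates]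

/-- The corresponding reindexing of the basis states. -/
noncomputable def ancArrow (I A : Type) [Fintype A] :
    (I ⊕ A → Bool) ≃ (I ⊕ Fin (Fintype.card A) → Bool) :=
  (ancEquiv I A).arrowCongr (Equiv.refl Bool)

theorem run_map_ancEquiv (gates : List (Gate (I ⊕ A))) (x : I → Bool) (v : I ⊕ A → Bool) :
    run (gates.map (Gate.map (ancEquiv I A).toEmbedding)) (basis (Sum.elim x fun _ => false))
      (ancArrow I A v) = run gates (basis (Sum.elim x fun _ => false)) v := by
  rw [run_map]
  congr 1
  · funext w
    have h2 : ∀ v', Function.extend (ancEquiv I A).toEmbedding w v' = w ∘ (ancEquiv I A).symm := by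
      intro v'
      funext i
      obtain ⟨j, rfl⟩ := (ancEquiv I A).surjective i
      rw [Function.comp_apply, Equiv.symm_apply_apply]
      exact (ancEquiv I A).toEmbedding.injective.extend_apply w v' j
    rw [h2]
    simp only [basis]
    congr 1
    rw [eq_iff_iff]
    constructor
    · intro h
      funext i
      have := congrFun h (ancEquiv I A i)
      rw [Function.comp_apply, Equiv.symm_apply_apply] at this
      rw [this]
      rcases i with i | i <;> rfl
    · rintro rfl
      funext i
      rcases i with i | i <;> simp [ancEquiv]
  · funext i
    simp [ancArrow]

theorem prob_ofGates (gates : List (Gate (I ⊕ A))) (out : O → I ⊕ A) (x : I → Bool)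
    (y : O → Bool) :
    (ofGates gates out).prob x y = ∑ v : I ⊕ A → Bool, if (fun o => v (out o)) = y then
      ‖run gates (basis (Sum.elim x fun _ => false)) v‖ ^ 2 else 0 := by
  symm
  refine Fintype.sum_equiv (ancArrow I A) _ _ fun v => ?_
  have h1 : (fun o => (ancArrow I A) v ((ofGates gates out).out o)) = fun o => v (out o) := by
    funext o; simp [ofGates, ancArrow]
  rw [← run_map_ancEquiv]
  exact if_congr (by rw [h1]) rfl rfl

end Circuit

/-! ## A phase query to a predictor -/

section PhaseQuery

variable {W : Type} [DecidableEq W]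

/-- The Pauli `Z` gate. -/
def zGates (w : W) : List (Gate W) := List.replicate 4 (Gate.T w)

theorem run_zGates (w : W) (ψ : State W) :
    run (zGates w) ψ = fun v => (if v w then -1 else 1) * ψ v := by
  funext v
  simp only [zGates, List.replicate, run_cons, run_nil, Gate.apply]
  cases v w
  · simp
  · have h : Complex.exp (Real.pi / 4 * Complex.I) ^ 4 = -1 := by
      rw [← Complex.exp_nat_mul, ← Complex.exp_pi_mul_I]
      congr 1
      push_cast; ring
    simp only [if_true]
    linear_combination ψ v * h

variable {J : Type} [Fintype J] [DecidableEq J]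

/-- Run the circuit, flip the phase if the output is `1`, and undo the computation. -/
def Circuit.phaseQuery (A : Circuit J (Fin 1)) : List (Gate (J ⊕ Fin A.anc)) :=
  A.gates ++ (zGates (A.out 0) ++ daggers A.gates)

/-- The probability of the output `0` minus the probability of the output `1`. -/
noncomputable def Circuit.bias (A : Circuit J (Fin 1)) (x : J → Bool) : ℝ :=
  ∑ v : J ⊕ Fin A.anc → Bool, (if v (A.out 0) then -1 else 1) * ‖A.final x v‖ ^ 2

theorem Circuit.bias_eq (A : Circuit J (Fin 1)) (x : J → Bool) :
    A.bias x = 1 - 2 * A.prob x fun _ => true := by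
  rw [← A.sum_norm_sq_final x, Circuit.bias, Circuit.prob, Finset.mul_sum,
    ← Finset.sum_sub_distrib]
  refine Finset.sum_congr rfl fun v _ => ?_
  have : ((fun o => v (A.out o)) = fun _ => true) ↔ v (A.out 0) = true := by
    constructor
    · intro h; exact congrFun h 0
    · intro h; funext o; rw [Subsingleton.elim o 0]; exact h
  simp only [this]
  split_ifs <;> ring

/-- This is the diagonal entry ⟨e|U†ZU|e⟩: moving U† to the left side turns it into the expectation
of Z on the output wire. The other components of the resulting state are never needed. -/
theorem Circuit.run_phaseQuery (A : Circuit J (Fin 1)) (x : J → Bool) :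
    run A.phaseQuery (basis (Sum.elim x fun _ => false)) (Sum.elim x fun _ => false) =
      (A.bias x : ℂ) := by
  set e : J ⊕ Fin A.anc → Bool := Sum.elim x fun _ => false with he
  have h := run_daggers_adjoint A.gates (basis e) (run (zGates (A.out 0)) (run A.gates (basis e)))
  have h1 : ∀ ψ : State (J ⊕ Fin A.anc), ∑ v, (starRingEnd ℂ) (basis e v) * ψ v = ψ e := by
    intro ψ; simp [basis]
  rw [h1] at h
  rw [Circuit.phaseQuery, run_append, run_append, h, run_zGates, Circuit.bias]
  push_cast
  refine Finset.sum_congr rfl fun v _ => ?_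
  rw [Circuit.final_eq_run, ← he, ← Complex.conj_mul']
  split_ifs <;> push_cast <;> ring

end PhaseQuery

/-! ## Extraction of a linear function from a predictor -/

section Extend

variable {α β γ : Type}

theorem extend_trans (f : α ↪ β) (e : β ↪ γ) (u : α → Bool) (v : γ → Bool) :
    Function.extend (f.trans e) u v = Function.extend e (Function.extend f u (v ∘ e)) v := by
  funext w
  by_cases hw : ∃ b, e b = w
  · obtain ⟨b, rfl⟩ := hw
    rw [e.injective.extend_apply]
    by_cases hb : ∃ a, f a = b
    · obtain ⟨a, rfl⟩ := hb
      rw [f.injective.extend_apply]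
      exact (f.trans e).injective.extend_apply _ _ a
    · rw [Function.extend_apply' _ _ _ hb, Function.extend_apply']
      · rfl
      · rintro ⟨a, ha⟩
        exact hb ⟨a, e.injective ha⟩
  · rw [Function.extend_apply' _ _ _ hw, Function.extend_apply']
    rintro ⟨a, ha⟩
    exact hw ⟨f a, ha⟩

theorem extend_inl (u a : α → Bool) (b : β → Bool) :
    Function.extend (Function.Embedding.inl : α ↪ α ⊕ β) u (Sum.elim a b) = Sum.elim u b := by
  funext w
  rcases w with w | w
  · exact (Function.Embedding.inl : α ↪ α ⊕ β).injective.extend_apply _ _ w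
  · rw [Function.extend_apply']
    · rfl
    · simp

theorem extend_inr (u b : β → Bool) (a : α → Bool) :
    Function.extend (Function.Embedding.inr : β ↪ α ⊕ β) u (Sum.elim a b) = Sum.elim a u := by
  funext w
  rcases w with w | w
  · rw [Function.extend_apply']
    · rfl
    · simp
  · exact (Function.Embedding.inr : β ↪ α ⊕ β).injective.extend_apply _ _ w

theorem elim_comp_inr_embedding (a : α → Bool) (b : β → Bool) :
    Sum.elim a b ∘ (Function.Embedding.inr : β ↪ α ⊕ β) = b := rfl

end Extend

theorem basis_apply_of_iff {α β : Type} [DecidableEq α] [DecidableEq β] [Fintype α] [Fintype β]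
    {a b : α → Bool} {c d : β → Bool} (h : a = b ↔ c = d) : basis b a = basis d c := by
  simp only [basis, h]

section Extraction

variable {Z R J O S : Type} [Fintype Z] [DecidableEq Z] [Fintype R] [DecidableEq R] [Fintype J]
  [DecidableEq J] [Fintype O] [Fintype S] [DecidableEq S]

/-- The wires with labels in `R`. -/
def wireR (Z R X : Type) : R ↪ Z ⊕ (R ⊕ X) := Function.Embedding.inl.trans Function.Embedding.inr

/-- The wires with labels in `X`. -/
def wireX (Z R X : Type) : X ↪ Z ⊕ (R ⊕ X) := Function.Embedding.inr.trans Function.Embedding.inr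

/-- The inclusion of the first two groups of wires. -/
def wireZR (Z R X : Type) : Z ⊕ R → Z ⊕ (R ⊕ X) := Sum.map id Sum.inl

variable (A : Circuit J (Fin 1)) (src : J → Z ⊕ R) (f : S ↪ R) (g : O ↪ R) (xs : O → Z)

/-- Copying the inputs of the predictor. -/
noncomputable def inputCopies : List (Gate (Z ⊕ (R ⊕ (J ⊕ Fin A.anc)))) :=
  copies (fun j => wireZR Z R (J ⊕ Fin A.anc) (src j))
    (fun j => wireX Z R (J ⊕ Fin A.anc) (Sum.inl j)) (by
      intro j j'
      rcases src j with z | r <;> simp [wireZR, wireX])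

/-- Adding the input bits `xs` to the output bits. -/
noncomputable def outputCopies : List (Gate (Z ⊕ (R ⊕ (J ⊕ Fin A.anc)))) :=
  copies (fun o => Sum.inl (xs o)) (fun o => wireR Z R (J ⊕ Fin A.anc) (g o)) (by
    intro j j'; simp [wireR])

/-- The gates of the extraction circuit, up to the additions of input bits to the output bits. -/
noncomputable def queryGates : List (Gate (Z ⊕ (R ⊕ (J ⊕ Fin A.anc)))) :=
  (hadamards R).map (Gate.map (wireR Z R _)) ++ (inputCopies A src ++
    (A.phaseQuery.map (Gate.map (wireX Z R _)) ++ (inputCopies A src ++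
      (hadamards S).map (Gate.map (f.trans (wireR Z R _))))))

/-- The extraction circuit: a phase query to the predictor in a superposition of the values of the
bits in `R`, followed by Hadamard gates on the bits in `S`; the output bits are sums of bits in `R`
and of input bits. -/
noncomputable def extraction : Circuit Z O :=
  Circuit.ofGates (queryGates A src f ++ outputCopies A g xs)
    (fun o => wireR Z R (J ⊕ Fin A.anc) (g o))

omit [Fintype Z] [DecidableEq Z] [Fintype R] [DecidableEq R] in
theorem extend_wireR {X : Type} (z : Z → Bool) (ρ u : R → Bool) (a : X → Bool) :
    Function.extend (wireR Z R X) u (Sum.elim z (Sum.elim ρ a)) = Sum.elim z (Sum.elim u a) := by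
  rw [wireR, extend_trans, elim_comp_inr_embedding, extend_inl, extend_inr]

omit [Fintype Z] [DecidableEq Z] [Fintype R] [DecidableEq R] in
theorem extend_wireX {X : Type} (z : Z → Bool) (ρ : R → Bool) (a u : X → Bool) :
    Function.extend (wireX Z R X) u (Sum.elim z (Sum.elim ρ a)) = Sum.elim z (Sum.elim ρ u) := by
  rw [wireX, extend_trans, elim_comp_inr_embedding, extend_inr, extend_inr]

omit [Fintype Z] [DecidableEq Z] [Fintype R] [DecidableEq R] [Fintype S] [DecidableEq S] in
theorem extend_trans_wireR {X : Type} (f : S ↪ R) (z : Z → Bool) (ρ : R → Bool) (u : S → Bool)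
    (a : X → Bool) : Function.extend (f.trans (wireR Z R X)) u (Sum.elim z (Sum.elim ρ a)) =
      Sum.elim z (Sum.elim (Function.extend f u ρ) a) := by
  rw [extend_trans, extend_wireR]; rfl

theorem run_hadamards_zero (ρ : R → Bool) :
    run (hadamards R) (basis fun _ => false) ρ = (1 / (Real.sqrt 2 : ℂ)) ^ Fintype.card R := by
  have : dotSign ρ (fun _ : R => false) = 1 := by simp [dotSign, bitSign]
  simp [run_hadamards, basis, this]

omit [Fintype Z] [Fintype R] in
theorem run_inputCopies (ψ : State (Z ⊕ (R ⊕ (J ⊕ Fin A.anc)))) (z : Z → Bool) (ρ : R → Bool)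
    (x : J → Bool) (a : Fin A.anc → Bool) :
    run (inputCopies A src) ψ (Sum.elim z (Sum.elim ρ (Sum.elim x a))) =
      ψ (Sum.elim z (Sum.elim ρ (Sum.elim (fun j => xor (x j) (Sum.elim z ρ (src j))) a))) := by
  have h := run_copies (fun j => wireZR Z R (J ⊕ Fin A.anc) (src j))
    (Function.Embedding.inl.trans (wireX Z R (J ⊕ Fin A.anc))) (by
      intro j j'
      rcases src j with z | r <;> simp [wireZR, wireX]) ψ
      (Sum.elim z (Sum.elim ρ (Sum.elim x a)))
  refine h.trans ?_
  rw [extend_trans, extend_wireX]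
  refine congrArg ψ (congrArg _ (congrArg _ ?_))
  refine (extend_inl _ _ _).trans (congrArg (fun t => Sum.elim t a) ?_)
  funext j
  congr 1
  change Sum.elim z (Sum.elim ρ (Sum.elim x a)) (Sum.map id Sum.inl (src j)) = _
  rcases src j with w | w <;> rfl

/-- Only amplitudes with clean work space are followed. There the query multiplies each branch of
the uniform superposition by the bias, and the last Hadamard gates take a Fourier transform in the
bits of `S`. -/
theorem run_queryGates (z : Z → Bool) (ρ : R → Bool) :
    run (queryGates A src f) (basis (Sum.elim z fun _ => false))
      (Sum.elim z (Sum.elim ρ fun _ => false)) =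
    (1 / (Real.sqrt 2 : ℂ)) ^ (Fintype.card R + Fintype.card S) *
      ∑ u : S → Bool, (dotSign (ρ ∘ f) u : ℂ) *
        (A.bias fun j => Sum.elim z (Function.extend f u ρ) (src j) : ℝ) := by
  have hzero : ∀ (α β : Type), (fun _ : α ⊕ β => false) =
      Sum.elim (fun _ => false) (fun _ => false) := by
    intro α β; funext w; rcases w with w | w <;> rfl
  set ψ₁ := run ((hadamards R).map (Gate.map (wireR Z R (J ⊕ Fin A.anc))))
    (basis (Sum.elim z fun _ => false)) with hψ₁
  have h₁ : ∀ ρ a, ψ₁ (Sum.elim z (Sum.elim ρ a)) =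
      (1 / (Real.sqrt 2 : ℂ)) ^ Fintype.card R * basis (fun _ => false) a := by
    intro ρ a
    rw [hψ₁, run_map]
    have e1 : (fun w => (basis (Sum.elim z fun _ => false) : State (Z ⊕ (R ⊕ (J ⊕ Fin A.anc))))
        (Function.extend (wireR Z R (J ⊕ Fin A.anc)) w (Sum.elim z (Sum.elim ρ a)))) =
        fun w => basis (fun _ => false) a * basis (fun _ => false) w := by
      funext w
      rw [extend_wireR, hzero R]
      simp only [basis, Sum.elim_eq_iff, true_and]
      by_cases hw : w = fun _ => false <;> by_cases ha : a = fun _ => false <;> simp [hw, ha]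
    rw [e1, run_smul]
    change _ * run (hadamards R) (basis fun _ => false) ρ = _
    rw [run_hadamards_zero, mul_comm]
  set ψ₂ := run (inputCopies A src) ψ₁ with hψ₂
  set ψ₃ := run (A.phaseQuery.map (Gate.map (wireX Z R (J ⊕ Fin A.anc)))) ψ₂ with hψ₃
  have h₃ : ∀ ρ, ψ₃ (Sum.elim z (Sum.elim ρ (Sum.elim (fun j => Sum.elim z ρ (src j))
      fun _ => false))) = (1 / (Real.sqrt 2 : ℂ)) ^ Fintype.card R *
        (A.bias fun j => Sum.elim z ρ (src j) : ℝ) := by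
    intro ρ
    rw [hψ₃, run_map]
    have e1 : (fun w => ψ₂ (Function.extend (wireX Z R (J ⊕ Fin A.anc)) w (Sum.elim z (Sum.elim ρ
        (Sum.elim (fun j => Sum.elim z ρ (src j)) fun _ => false))))) =
        fun w => (1 / (Real.sqrt 2 : ℂ)) ^ Fintype.card R *
          basis (Sum.elim (fun j => Sum.elim z ρ (src j)) fun _ => false) w := by
      funext w
      rw [extend_wireX]
      obtain ⟨x, a, rfl⟩ : ∃ x a, w = Sum.elim x a := ⟨w ∘ Sum.inl, w ∘ Sum.inr, by simp⟩
      rw [hψ₂, run_inputCopies, h₁]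
      congr 1
      refine basis_apply_of_iff ?_
      rw [hzero J, Sum.elim_eq_iff, Sum.elim_eq_iff]
      refine and_congr_left fun _ => ?_
      simp only [funext_iff]
      refine forall_congr' fun j => ?_
      cases x j <;> cases Sum.elim z ρ (src j) <;> simp
    rw [e1, run_smul]
    change _ * run A.phaseQuery _ (Sum.elim (fun j => Sum.elim z ρ (src j)) fun _ => false) = _
    rw [A.run_phaseQuery]
  set ψ₄ := run (inputCopies A src) ψ₃ with hψ₄
  -- The second copying erases the first, so zero work space now corresponds to the predictor having
  -- returned to its starting basis state.
  have h₄ : ∀ ρ, ψ₄ (Sum.elim z (Sum.elim ρ fun _ => false)) =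
      (1 / (Real.sqrt 2 : ℂ)) ^ Fintype.card R *
        (A.bias fun j => Sum.elim z ρ (src j) : ℝ) := by
    intro ρ
    rw [hψ₄, hzero J, run_inputCopies]
    simp only [Bool.false_xor]
    exact h₃ ρ
  rw [queryGates, run_append, run_append, run_append, run_append, ← hψ₁, ← hψ₂, ← hψ₃, ← hψ₄,
    run_map]
  simp only [extend_trans_wireR, h₄]
  rw [run_hadamards, pow_add, mul_comm (_ ^ _) (_ ^ _), mul_assoc]
  congr 1
  rw [Finset.mul_sum]
  refine Finset.sum_congr rfl fun u _ => ?_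
  have : Sum.elim z (Sum.elim ρ fun _ => false) ∘ (f.trans (wireR Z R (J ⊕ Fin A.anc))) = ρ ∘ f :=
    rfl
  rw [this]
  ring

omit [Fintype Z] [Fintype R] [Fintype J] in
theorem run_outputCopies (ψ : State (Z ⊕ (R ⊕ (J ⊕ Fin A.anc)))) (z : Z → Bool) (ρ : R → Bool)
    (a : J ⊕ Fin A.anc → Bool) :
    run (outputCopies A g xs) ψ (Sum.elim z (Sum.elim ρ a)) =
      ψ (Sum.elim z (Sum.elim (Function.extend g (fun o => xor (ρ (g o)) (z (xs o))) ρ) a)) := by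
  have h := run_copies (fun o => (Sum.inl (xs o) : Z ⊕ (R ⊕ (J ⊕ Fin A.anc))))
    (g.trans (wireR Z R (J ⊕ Fin A.anc))) (by intro j j'; simp [wireR]) ψ
    (Sum.elim z (Sum.elim ρ a))
  refine h.trans ?_
  rw [extend_trans, extend_wireR]
  rfl

/-- The success probability of the extraction circuit, bounded from below by the part of the final
state in which the work space of the predictor is zero again. -/
theorem le_prob_extraction (z : Z → Bool) (y : O → Bool) :
    (1 / 2) ^ (Fintype.card R + Fintype.card S) *
      (∑ ρ : R → Bool, if (fun o => ρ (g o)) = fun o => xor (y o) (z (xs o)) then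
        (∑ u : S → Bool, (dotSign (ρ ∘ f) u : ℝ) *
          A.bias fun j => Sum.elim z (Function.extend f u ρ) (src j)) ^ 2 else 0) ≤
      (extraction A src f g xs).prob z y := by
  rw [extraction, Circuit.prob_ofGates]
  -- The output copying permutes basis states by the involution `τ`, so the amplitude before copying
  -- at `ρ` is found afterwards at `τ ρ`.
  set τ : (R → Bool) → R → Bool :=
    fun ρ => Function.extend g (fun o => xor (ρ (g o)) (z (xs o))) ρ with hτ
  have hτg : ∀ ρ o, τ ρ (g o) = xor (ρ (g o)) (z (xs o)) := fun ρ o =>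
    g.injective.extend_apply _ _ o
  have hττ : Function.Involutive τ := by
    intro ρ
    have : (fun o => xor (τ ρ (g o)) (z (xs o))) = ρ ∘ g := by
      funext o; simp [hτg]
    change Function.extend g _ _ = _
    rw [this, hτ]
    simp only
    rw [extend_extend, extend_self_comp]
  let emb : (R → Bool) ↪ (Z ⊕ (R ⊕ (J ⊕ Fin A.anc)) → Bool) :=
    ⟨fun ρ => Sum.elim z (Sum.elim (τ ρ) fun _ => false), by
      intro ρ ρ' h
      rw [Sum.elim_eq_iff, Sum.elim_eq_iff] at h
      exact hττ.injective h.2.1⟩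
  -- Measurement outcomes with input wires other than `z` or a nonzero work space are discarded;
  -- this is the only loss.
  refine le_trans ?_ (Finset.sum_le_sum_of_subset_of_nonneg
    (Finset.subset_univ (Finset.univ.map emb)) fun v _ _ => by split_ifs <;> positivity)
  rw [Finset.sum_map, Finset.mul_sum]
  refine Finset.sum_le_sum fun ρ _ => le_of_eq ?_
  have hcond : ((fun o => emb ρ (wireR Z R (J ⊕ Fin A.anc) (g o))) = y) ↔
      ((fun o => ρ (g o)) = fun o => xor (y o) (z (xs o))) := by
    have : ∀ o, emb ρ (wireR Z R (J ⊕ Fin A.anc) (g o)) = xor (ρ (g o)) (z (xs o)) :=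
      fun o => hτg ρ o
    simp only [this, funext_iff]
    refine forall_congr' fun o => ?_
    cases ρ (g o) <;> cases y o <;> cases z (xs o) <;> simp
  have hrun : run (queryGates A src f ++ outputCopies A g xs) (basis (Sum.elim z fun _ => false))
      (emb ρ) = run (queryGates A src f) (basis (Sum.elim z fun _ => false))
        (Sum.elim z (Sum.elim ρ fun _ => false)) := by
    rw [run_append]
    change run (outputCopies A g xs) _ (Sum.elim z (Sum.elim (τ ρ) fun _ => false)) = _
    rw [run_outputCopies]
    change _ = run (queryGates A src f) _ (Sum.elim z (Sum.elim ρ fun _ => false))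
    have := hττ ρ
    change Function.extend g (fun o => xor (τ ρ (g o)) (z (xs o))) (τ ρ) = ρ at this
    rw [this]
  rw [hrun, run_queryGates]
  have hsum : (∑ u : S → Bool, (dotSign (ρ ∘ f) u : ℂ) *
      ((A.bias fun j => Sum.elim z (Function.extend f u ρ) (src j) : ℝ) : ℂ)) =
      ((∑ u : S → Bool, (dotSign (ρ ∘ f) u : ℝ) *
        A.bias fun j => Sum.elim z (Function.extend f u ρ) (src j) : ℝ) : ℂ) := by
    push_cast; rfl
  have hc : ‖(1 / (Real.sqrt 2 : ℂ))‖ ^ 2 = 1 / 2 := by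
    rw [norm_div, norm_one, Complex.norm_real, Real.norm_eq_abs, div_pow, sq_abs,
      Real.sq_sqrt (by norm_num), one_pow]
  rw [hsum, norm_mul, mul_pow, norm_pow, ← pow_mul, mul_comm _ 2, pow_mul, hc,
    Complex.norm_real, Real.norm_eq_abs, sq_abs, if_congr hcond rfl rfl, mul_ite, mul_zero]

omit [DecidableEq Z] [DecidableEq R] [DecidableEq J] [DecidableEq S] in
theorem size_extraction : (extraction A src f g xs).size =
    Fintype.card Z + (Fintype.card R + (Fintype.card J + A.anc)) +
      (Fintype.card R + 2 * Fintype.card J + 2 * A.gates.length + 4 + Fintype.card S +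
        Fintype.card O) + Fintype.card O := by
  rw [extraction, Circuit.size_ofGates]
  simp [queryGates, inputCopies, outputCopies, length_copies, length_hadamards,
    Circuit.phaseQuery, zGates, daggers]
  ring

end Extraction

/-! ## Evaluating a function before running a circuit -/

section Composition

variable {I M O : Type} [Fintype I] [DecidableEq I] [Fintype M] [DecidableEq M] [Fintype O]
  (C : Circuit I M) (D : Circuit (I ⊕ M) O)

/-- The wires of a circuit with inputs `I ⊕ M` inside the composition. -/
def wireIM (I Y M X : Type) : (I ⊕ M) ⊕ X ↪ I ⊕ (Y ⊕ (M ⊕ X)) where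
  toFun := Sum.elim (Sum.map id fun m => Sum.inr (Sum.inl m)) fun a => Sum.inr (Sum.inr (Sum.inr a))
  inj' := by
    rintro ((i | m) | a) ((i' | m') | a') h <;> simp at h <;> simp [h]

omit [Fintype I] [DecidableEq I] [Fintype M] [DecidableEq M] in
theorem elim_comp_wireIM {Y X : Type} (x : I → Bool) (c : Y → Bool) (y : M → Bool) (a : X → Bool) :
    Sum.elim x (Sum.elim c (Sum.elim y a)) ∘ wireIM I Y M X = Sum.elim (Sum.elim x y) a := by
  funext w
  rcases w with (w | w) | w <;> rfl

omit [Fintype I] [DecidableEq I] [Fintype M] [DecidableEq M] in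
theorem extend_wireIM {Y X : Type} (x x' : I → Bool) (c : Y → Bool) (y y' : M → Bool)
    (a a' : X → Bool) : Function.extend (wireIM I Y M X) (Sum.elim (Sum.elim x' y') a')
      (Sum.elim x (Sum.elim c (Sum.elim y a))) = Sum.elim x' (Sum.elim c (Sum.elim y' a')) := by
  funext w
  rcases w with w | w | w | w
  · exact (wireIM I Y M X).injective.extend_apply _ _ (Sum.inl (Sum.inl w))
  · rw [Function.extend_apply']
    · rfl
    · rintro ⟨(i | m) | a, h⟩
      · cases (show (Sum.inl i : I ⊕ (Y ⊕ (M ⊕ X))) = Sum.inr (Sum.inl w) from h)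
      · cases (show (Sum.inr (Sum.inr (Sum.inl m)) : I ⊕ (Y ⊕ (M ⊕ X))) =
          Sum.inr (Sum.inl w) from h)
      · cases (show (Sum.inr (Sum.inr (Sum.inr a)) : I ⊕ (Y ⊕ (M ⊕ X))) =
          Sum.inr (Sum.inl w) from h)
  · exact (wireIM I Y M X).injective.extend_apply _ _ (Sum.inl (Sum.inr w))
  · exact (wireIM I Y M X).injective.extend_apply _ _ (Sum.inr w)

/-- Copying the input for the first circuit. -/
noncomputable def firstCopies (X : Type) [DecidableEq X] :
    List (Gate (I ⊕ ((I ⊕ Fin C.anc) ⊕ X))) :=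
  copies (fun i => Sum.inl i) (fun i => wireR I (I ⊕ Fin C.anc) X (Sum.inl i))
    (by intro i i'; simp [wireR])

/-- Copying the output of the first circuit for the second one. -/
noncomputable def secondCopies (X : Type) [DecidableEq X] :
    List (Gate (I ⊕ ((I ⊕ Fin C.anc) ⊕ (M ⊕ X)))) :=
  copies (fun m => wireR I (I ⊕ Fin C.anc) (M ⊕ X) (C.out m))
    (fun m => wireX I (I ⊕ Fin C.anc) (M ⊕ X) (Sum.inl m))
    (by intro i i'; simp [wireR, wireX])

/-- The gates of the composition. -/
noncomputable def compGates : List (Gate (I ⊕ ((I ⊕ Fin C.anc) ⊕ (M ⊕ Fin D.anc)))) :=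
  firstCopies C (M ⊕ Fin D.anc) ++ (C.gates.map (Gate.map (wireR I _ _)) ++
    (secondCopies C (Fin D.anc) ++ D.gates.map (Gate.map (wireIM I _ M _))))

/-- The circuit which runs `D` on the input and the output of `C`. -/
noncomputable def compCircuit : Circuit I O :=
  Circuit.ofGates (compGates C D) fun o => wireIM I (I ⊕ Fin C.anc) M (Fin D.anc) (D.out o)

omit [Fintype M] [DecidableEq M] in
theorem run_firstCopies {X : Type} [DecidableEq X] [Fintype X]
    (ψ : State (I ⊕ ((I ⊕ Fin C.anc) ⊕ X))) (x c : I → Bool) (b : Fin C.anc → Bool)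
    (a : X → Bool) :
    run (firstCopies C X) ψ (Sum.elim x (Sum.elim (Sum.elim c b) a)) =
      ψ (Sum.elim x (Sum.elim (Sum.elim (fun i => xor (c i) (x i)) b) a)) := by
  have h := run_copies (fun i => (Sum.inl i : I ⊕ ((I ⊕ Fin C.anc) ⊕ X)))
    (Function.Embedding.inl.trans (wireR I (I ⊕ Fin C.anc) X)) (by intro j j'; simp [wireR]) ψ
    (Sum.elim x (Sum.elim (Sum.elim c b) a))
  refine h.trans ?_
  rw [extend_trans, extend_wireR]
  refine congrArg ψ (congrArg _ (congrArg (fun t => Sum.elim t a) ?_))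
  exact extend_inl _ _ _

omit [Fintype I] in
theorem run_secondCopies {X : Type} [DecidableEq X] [Fintype X]
    (ψ : State (I ⊕ ((I ⊕ Fin C.anc) ⊕ (M ⊕ X)))) (x : I → Bool) (c : I ⊕ Fin C.anc → Bool)
    (y : M → Bool) (a : X → Bool) :
    run (secondCopies C X) ψ (Sum.elim x (Sum.elim c (Sum.elim y a))) =
      ψ (Sum.elim x (Sum.elim c (Sum.elim (fun m => xor (y m) (c (C.out m))) a))) := by
  have h := run_copies (fun m => wireR I (I ⊕ Fin C.anc) (M ⊕ X) (C.out m))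
    (Function.Embedding.inl.trans (wireX I (I ⊕ Fin C.anc) (M ⊕ X)))
    (by intro j j'; simp [wireR, wireX]) ψ (Sum.elim x (Sum.elim c (Sum.elim y a)))
  refine h.trans ?_
  rw [extend_trans, extend_wireX]
  refine congrArg ψ (congrArg _ (congrArg _ ?_))
  exact extend_inl _ _ _

-- Copying the output of `C` correlates the input of `D` with the final basis state `c` of `C`. The
-- wires of `C` are kept, so distinct `c` do not interfere and the amplitude is a product.
omit [Fintype O] in
theorem run_compGates (x : I → Bool) (c : I ⊕ Fin C.anc → Bool) (x' : I → Bool) (y : M → Bool)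
    (a : Fin D.anc → Bool) :
    run (compGates C D) (basis (Sum.elim x fun _ => false))
      (Sum.elim x' (Sum.elim c (Sum.elim y a))) =
    C.final x c * D.final (Sum.elim x fun m => c (C.out m)) (Sum.elim (Sum.elim x' y) a) := by
  have hzero : ∀ (α β : Type), (fun _ : α ⊕ β => false) =
      Sum.elim (fun _ => false) (fun _ => false) := by
    intro α β; funext w; rcases w with w | w <;> rfl
  set ψ₁ := run (firstCopies C (M ⊕ Fin D.anc)) (basis (Sum.elim x fun _ => false)) with hψ₁
  have h₁ : ∀ x' c a, ψ₁ (Sum.elim x' (Sum.elim c a)) =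
      basis (Sum.elim x fun _ => false) (Sum.elim x' a) *
        basis (Sum.elim x fun _ => false) c := by
    intro x' c a
    obtain ⟨c, b, rfl⟩ : ∃ c' b', c = Sum.elim c' b' := ⟨c ∘ Sum.inl, c ∘ Sum.inr, by simp⟩
    rw [hψ₁, run_firstCopies, hzero (I ⊕ Fin C.anc), hzero I]
    simp only [basis, Sum.elim_eq_iff]
    by_cases hx : x' = x
    · subst hx
      have : ((fun i => xor (c i) (x' i)) = fun _ => false) ↔ c = x' := by
        simp only [funext_iff]
        refine forall_congr' fun i => ?_
        cases c i <;> cases x' i <;> simp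
      simp only [this, true_and, ← ite_and, mul_ite, mul_one, mul_zero]
    · simp [hx]
  set ψ₂ := run (C.gates.map (Gate.map (wireR I (I ⊕ Fin C.anc) (M ⊕ Fin D.anc)))) ψ₁ with hψ₂
  have h₂ : ∀ x' c a, ψ₂ (Sum.elim x' (Sum.elim c a)) =
      basis (Sum.elim x fun _ => false) (Sum.elim x' a) * C.final x c := by
    intro x' c a
    rw [hψ₂, run_map]
    simp only [extend_wireR, h₁]
    rw [run_smul]
    rfl
  set ψ₃ := run (secondCopies C (Fin D.anc)) ψ₂ with hψ₃
  rw [compGates, run_append, run_append, run_append, ← hψ₁, ← hψ₂, ← hψ₃, run_map,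
    elim_comp_wireIM]
  have h₃ : (fun w => ψ₃ (Function.extend (wireIM I (I ⊕ Fin C.anc) M (Fin D.anc)) w
      (Sum.elim x' (Sum.elim c (Sum.elim y a))))) = fun w => C.final x c *
        basis (Sum.elim (Sum.elim x fun m => c (C.out m)) fun _ => false) w := by
    funext w
    obtain ⟨x₁, y₁, a₁, rfl⟩ : ∃ x₁ y₁ a₁, w = Sum.elim (Sum.elim x₁ y₁) a₁ :=
      ⟨w ∘ Sum.inl ∘ Sum.inl, w ∘ Sum.inl ∘ Sum.inr, w ∘ Sum.inr, by
        funext i; rcases i with (i | i) | i <;> rfl⟩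
    rw [extend_wireIM, hψ₃, run_secondCopies, h₂, mul_comm]
    congr 1
    refine basis_apply_of_iff ?_
    rw [hzero M, Sum.elim_eq_iff, Sum.elim_eq_iff, Sum.elim_eq_iff, Sum.elim_eq_iff, and_assoc]
    refine and_congr_right fun _ => and_congr_left fun _ => ?_
    simp only [funext_iff]
    refine forall_congr' fun m => ?_
    cases y₁ m <;> cases c (C.out m) <;> simp
  rw [h₃, run_smul]
  rfl

theorem prob_le_prob_compCircuit (x : I → Bool) (y : M → Bool) (hy : C.prob x y = 1)
    (o : O → Bool) : D.prob (Sum.elim x y) o ≤ (compCircuit C D).prob x o := by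
  -- Since `C` outputs `y` with certainty, inserting the factor `C.prob x y` turns the left side
  -- into a sum over pairs of final basis states of `C` and `D`, which embed into the basis states
  -- of the composition.
  rw [compCircuit, Circuit.prob_ofGates, ← one_mul (D.prob _ _), ← hy, Circuit.prob, Circuit.prob,
    Finset.sum_mul_sum, ← Finset.sum_product']
  let emb : (I ⊕ Fin C.anc → Bool) × ((I ⊕ M) ⊕ Fin D.anc → Bool) ↪
      (I ⊕ ((I ⊕ Fin C.anc) ⊕ (M ⊕ Fin D.anc)) → Bool) :=
    ⟨fun p => Sum.elim (p.2 ∘ Sum.inl ∘ Sum.inl) (Sum.elim p.1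
      (Sum.elim (p.2 ∘ Sum.inl ∘ Sum.inr) (p.2 ∘ Sum.inr))), by
      rintro ⟨c, w⟩ ⟨c', w'⟩ h
      simp only [Sum.elim_eq_iff] at h
      obtain ⟨h1, h2, h3, h4⟩ := h
      refine Prod.ext h2 (funext fun i => ?_)
      rcases i with (i | i) | i
      · exact congrFun h1 i
      · exact congrFun h3 i
      · exact congrFun h4 i⟩
  refine le_trans ?_ (Finset.sum_le_sum_of_subset_of_nonneg
    (Finset.subset_univ (Finset.univ.map emb)) fun v _ _ => by split_ifs <;> positivity)
  rw [Finset.sum_map]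
  refine Finset.sum_le_sum ?_
  rintro ⟨c, w⟩ _
  have hw : Sum.elim (Sum.elim (w ∘ Sum.inl ∘ Sum.inl) (w ∘ Sum.inl ∘ Sum.inr)) (w ∘ Sum.inr) = w := by
    funext i; rcases i with (i | i) | i <;> rfl
  have hcond : (fun o => emb (c, w) (wireIM I (I ⊕ Fin C.anc) M (Fin D.anc) (D.out o))) =
      fun o => w (D.out o) := by
    funext o
    have := congrFun (elim_comp_wireIM (w ∘ Sum.inl ∘ Sum.inl) c (w ∘ Sum.inl ∘ Sum.inr)
      (w ∘ Sum.inr)) (D.out o)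
    rw [hw] at this
    exact this
  rw [hcond]
  by_cases hc : (fun m => c (C.out m)) = y
  · by_cases ho : (fun o => w (D.out o)) = o
    · simp only [hc, ho, if_true]
      change _ ≤ ‖run (compGates C D) _ (Sum.elim (w ∘ Sum.inl ∘ Sum.inl) (Sum.elim c
        (Sum.elim (w ∘ Sum.inl ∘ Sum.inr) (w ∘ Sum.inr))))‖ ^ 2
      rw [run_compGates, hw, hc, norm_mul, mul_pow]
    · simp [ho]
  · simp only [hc, if_false, zero_mul]
    split_ifs <;> positivity

omit [DecidableEq I] in
theorem size_compCircuit : (compCircuit C D).size =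
    Fintype.card I + (Fintype.card I + C.anc + (Fintype.card M + D.anc)) +
      (Fintype.card I + C.gates.length + Fintype.card M + D.gates.length) + Fintype.card O := by
  rw [compCircuit, Circuit.size_ofGates]
  simp [compGates, firstCopies, secondCopies, length_copies]
  ring

end Composition

/-! ## Classical computations -/

section Classical

variable {W W' : Type} [DecidableEq W] [DecidableEq W']

/-- The action of the gates `X`, `CNOT` and `Toffoli` on basis states. -/
def Gate.act : Gate W → (W → Bool) → W → Bool
  | .X t, v => Function.update v t (!(v t))
  | .CNOT c t _, v => Function.update v t (xor (v t) (v c))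
  | .Toffoli c d t _ _ _, v => Function.update v t (xor (v t) (v c && v d))
  | _, v => v

/-- The gates `X`, `CNOT` and `Toffoli`. -/
def Gate.IsClassical : Gate W → Prop
  | .X _ => True
  | .CNOT _ _ _ => True
  | .Toffoli _ _ _ _ _ _ => True
  | _ => False

/-- The action of a list of classical gates on basis states. -/
def actList (gs : List (Gate W)) (v : W → Bool) : W → Bool := gs.foldl (fun v g => g.act v) v

theorem actList_cons (g : Gate W) (gs : List (Gate W)) (v : W → Bool) :
    actList (g :: gs) v = actList gs (g.act v) := rfl

theorem actList_append (gs hs : List (Gate W)) (v : W → Bool) :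
    actList (gs ++ hs) v = actList hs (actList gs v) := by
  simp [actList, List.foldl_append]

theorem basis_comp_involutive [Fintype W] {σ : (W → Bool) → W → Bool}
    (hσ : Function.Involutive σ) (u : W → Bool) : (fun v => basis u (σ v)) = basis (σ u) := by
  funext v
  exact basis_apply_of_iff hσ.eq_iff

theorem Gate.apply_basis [Fintype W] (g : Gate W) (hg : g.IsClassical) (u : W → Bool) :
    g.apply (basis u) = basis (g.act u) := by
  cases g with
  | X t =>
    exact basis_comp_involutive (σ := fun v => Function.update v t (!(v t))) (fun v => by simp) u
  | CNOT c t h =>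
    exact basis_comp_involutive (involutive_update t (fun v => v c) fun v b => by simp [h]) u
  | Toffoli c d t h₁ h₂ h₃ =>
    exact basis_comp_involutive
      (involutive_update t (fun v => v c && v d) fun v b => by simp [h₂, h₃]) u
  | H t => exact hg.elim
  | T t => exact hg.elim
  | Tdg t => exact hg.elim

theorem run_basis [Fintype W] (gs : List (Gate W)) (hgs : ∀ g ∈ gs, g.IsClassical)
    (u : W → Bool) : run gs (basis u) = basis (actList gs u) := by
  induction gs generalizing u with
  | nil => rfl
  | cons g gs ih =>
    rw [run_cons, Gate.apply_basis g (hgs g (by simp)), ih fun g hg => hgs g (by simp [hg])]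
    rfl

theorem Gate.act_map_inr {I : Type} [DecidableEq I] (g : Gate W) (x : I → Bool) (v : W → Bool) :
    (g.map (Function.Embedding.inr : W ↪ I ⊕ W)).act (Sum.elim x v) = Sum.elim x (g.act v) := by
  cases g <;> simp only [Gate.map, Gate.act, Function.Embedding.inr_apply, Sum.elim_inr,
    Sum.update_elim_inr]

theorem actList_map_inr {I : Type} [DecidableEq I] (gs : List (Gate W)) (x : I → Bool)
    (v : W → Bool) :
    actList (gs.map (Gate.map (Function.Embedding.inr : W ↪ I ⊕ W))) (Sum.elim x v) =
      Sum.elim x (actList gs v) := by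
  induction gs generalizing v with
  | nil => rfl
  | cons g gs ih =>
    rw [List.map_cons, actList_cons, Gate.act_map_inr, ih, actList_cons]

omit [DecidableEq W] [DecidableEq W'] in
theorem Gate.isClassical_map (f : W ↪ W') (g : Gate W) (hg : g.IsClassical) :
    (g.map f).IsClassical := by
  cases g <;> exact hg

end Classical

/-! ## Addition modulo 8 -/

section Adder

/-- Gates on wires `0, 1, 2` (an accumulator modulo 8), `3` (the control) and `4` (a carry) which
add `k` to the accumulator if the control is `1`. -/
def adder (k : ZMod 8) : List (Gate (Fin 5)) :=
  (if k.val.testBit 0 then [.Toffoli 1 2 4 (by decide) (by decide) (by decide),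
    .Toffoli 3 4 0 (by decide) (by decide) (by decide),
    .Toffoli 1 2 4 (by decide) (by decide) (by decide),
    .Toffoli 3 2 1 (by decide) (by decide) (by decide), .CNOT 3 2 (by decide)] else []) ++
  (if k.val.testBit 1 then [.Toffoli 3 1 0 (by decide) (by decide) (by decide),
    .CNOT 3 1 (by decide)] else []) ++
  (if k.val.testBit 2 then [.CNOT 3 0 (by decide)] else [])

/-- The state of the adder with accumulator `t` and control `b`. -/
def adderState (t : ZMod 8) (b : Bool) : Fin 5 → Bool :=
  ![toThreeBits t 0, toThreeBits t 1, toThreeBits t 2, b, false]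

/-- A finite check. Each set bit of `k` is added with its carries propagated upwards, and the carry
wire is restored to zero. -/
theorem actList_adder (k t : ZMod 8) (b : Bool) :
    actList (adder k) (adderState t b) = adderState (t + if b then k else 0) b := by
  revert k t b
  decide

theorem length_adder_le (k : ZMod 8) : (adder k).length ≤ 8 := by
  revert k
  decide

theorem isClassical_adder (k : ZMod 8) : ∀ g ∈ adder k, g.IsClassical := by
  intro g hg
  simp only [adder, List.mem_append] at hg
  rcases hg with (hg | hg) | hg <;> split_ifs at hg <;> simp at hg
  · rcases hg with rfl | rfl | rfl | rfl | rfl <;> trivial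
  · rcases hg with rfl | rfl <;> trivial
  · subst hg; trivial

variable {X B : Type} [DecidableEq X] [DecidableEq B]

/-- Adding `k` to the accumulator if the bits on the two input wires are both `1`. -/
def mulAdder (p : X × B × ZMod 8) : List (Gate ((X ⊕ B) ⊕ Fin 5)) :=
  .Toffoli (Sum.inl (Sum.inl p.1)) (Sum.inl (Sum.inr p.2.1)) (Sum.inr 3) (by simp) (by simp)
    (by simp) :: ((adder p.2.2).map (Gate.map Function.Embedding.inr) ++
  [.Toffoli (Sum.inl (Sum.inl p.1)) (Sum.inl (Sum.inr p.2.1)) (Sum.inr 3) (by simp) (by simp)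
    (by simp)])

theorem update_adderState (t : ZMod 8) (b b' : Bool) :
    Function.update (adderState t b) 3 b' = adderState t b' := by
  funext i; fin_cases i <;> rfl

theorem actList_mulAdder (p : X × B × ZMod 8) (x : X ⊕ B → Bool) (t : ZMod 8) :
    actList (mulAdder p) (Sum.elim x (adderState t false)) = Sum.elim x (adderState
      (t + if x (Sum.inl p.1) && x (Sum.inr p.2.1) then p.2.2 else 0) false) := by
  have h : ∀ t b, (Gate.Toffoli (Sum.inl (Sum.inl p.1)) (Sum.inl (Sum.inr p.2.1)) (Sum.inr 3)
      (by simp) (by simp) (by simp) : Gate ((X ⊕ B) ⊕ Fin 5)).act (Sum.elim x (adderState t b)) =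
      Sum.elim x (adderState t (xor b (x (Sum.inl p.1) && x (Sum.inr p.2.1)))) := by
    intro t b
    simp only [Gate.act, Sum.elim_inl, Sum.elim_inr, Sum.update_elim_inr, update_adderState]
    rfl
  rw [mulAdder, actList_cons, h, actList_append, actList_map_inr, actList_adder, actList_cons, h]
  simp [actList]

theorem actList_mulAdders (l : List (X × B × ZMod 8)) (x : X ⊕ B → Bool) (t : ZMod 8) :
    actList (l.flatMap mulAdder) (Sum.elim x (adderState t false)) = Sum.elim x (adderState
      (t + (l.map fun p => if x (Sum.inl p.1) && x (Sum.inr p.2.1) then p.2.2 else 0).sum)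
        false) := by
  induction l generalizing t with
  | nil => simp [actList]
  | cons p l ih =>
    rw [List.flatMap_cons, actList_append, actList_mulAdder, ih, List.map_cons, List.sum_cons,
      add_assoc]

omit [DecidableEq X] [DecidableEq B] in
theorem isClassical_mulAdders (l : List (X × B × ZMod 8)) :
    ∀ g ∈ l.flatMap mulAdder, g.IsClassical := by
  intro g hg
  obtain ⟨p, _, hg⟩ := List.mem_flatMap.mp hg
  simp only [mulAdder, List.mem_cons, List.mem_append, List.mem_map, List.not_mem_nil,
    or_false] at hg
  rcases hg with rfl | ⟨g', hg', rfl⟩ | rfl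
  · trivial
  · exact Gate.isClassical_map _ _ (isClassical_adder _ _ hg')
  · trivial

omit [DecidableEq X] [DecidableEq B] in
theorem length_mulAdders_le (l : List (X × B × ZMod 8)) :
    (l.flatMap mulAdder).length ≤ 10 * l.length := by
  induction l with
  | nil => simp
  | cons p l ih =>
    have := length_adder_le p.2.2
    simp only [List.flatMap_cons, List.length_append, mulAdder, List.length_cons, List.length_map,
      List.length_nil]
    omega

end Adder

/-! ## Computing `θ` -/

section Theta

/-- The inclusion of the first `n - 1` positions. -/
def initPos (n : ℕ) (i : Fin (n - 1)) : Fin n := Fin.castLE (Nat.sub_le n 1) i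

/-- The products which make up `(x_i - x'_i) (4 b_i + α_i)`. -/
def thetaTerms (n : ℕ) (i : Fin (n - 1)) : List ((Fin n ⊕ Fin n) × AngleBits n × ZMod 8) :=
  [(Sum.inl (initPos n i), Sum.inr i, 4), (Sum.inr (initPos n i), Sum.inr i, -4),
    (Sum.inl (initPos n i), Sum.inl (i, 0), 4), (Sum.inr (initPos n i), Sum.inl (i, 0), -4),
    (Sum.inl (initPos n i), Sum.inl (i, 1), 2), (Sum.inr (initPos n i), Sum.inl (i, 1), -2),
    (Sum.inl (initPos n i), Sum.inl (i, 2), 1), (Sum.inr (initPos n i), Sum.inl (i, 2), -1)]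

/-- The reassociation of the input wires. -/
def assocWires (X Y B A : Type) : ((X ⊕ Y) ⊕ B) ⊕ A ↪ (X ⊕ Y ⊕ B) ⊕ A :=
  (Equiv.sumCongr (Equiv.sumAssoc X Y B) (Equiv.refl A)).toEmbedding

/-- The circuit which computes `θ`. -/
noncomputable def thetaCircuit (n : ℕ) : Circuit (Fin n ⊕ Fin n ⊕ AngleBits n) (Fin 3) :=
  Circuit.ofGates ((((List.finRange (n - 1)).flatMap (thetaTerms n)).flatMap mulAdder).map
    (Gate.map (assocWires _ _ _ (Fin 5)))) fun j => Sum.inr (Fin.castLE (by norm_num) j)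

theorem sum_products (a a' b b₀ b₁ b₂ : Bool) :
    (if a && b then (4 : ZMod 8) else 0) + ((if a' && b then -4 else 0) +
      ((if a && b₀ then 4 else 0) + ((if a' && b₀ then -4 else 0) +
      ((if a && b₁ then 2 else 0) + ((if a' && b₁ then -2 else 0) +
      ((if a && b₂ then 1 else 0) + ((if a' && b₂ then -1 else 0) + 0))))))) =
    ((a.toNat : ZMod 8) - (a'.toNat : ZMod 8)) * (4 * (b.toNat : ZMod 8) +
      (4 * (b₀.toNat : ZMod 8) + 2 * (b₁.toNat : ZMod 8) + (b₂.toNat : ZMod 8))) := by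
  revert a a' b b₀ b₁ b₂
  decide

theorem thetaTerms_sum (n : ℕ) (x x' : BitString n) (β : AngleBits n → Bool) :
    (((List.finRange (n - 1)).flatMap (thetaTerms n)).map fun p =>
      if Sum.elim (Sum.elim x x') β (Sum.inl p.1) && Sum.elim (Sum.elim x x') β (Sum.inr p.2.1)
        then p.2.2 else 0).sum =
    thetaZMod n x x' (fun i j => β (Sum.inl (i, j))) (fun i => β (Sum.inr i)) := by
  rw [List.map_flatMap, List.flatMap, List.sum_flatten, List.map_map, thetaZMod,
    ← Fin.sum_ofFn, List.ofFn_eq_map]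
  congr 1
  refine List.map_congr_left fun i _ => ?_
  simp only [Function.comp_apply, thetaTerms, List.map_cons, List.map_nil, List.sum_cons,
    List.sum_nil, Sum.elim_inl, Sum.elim_inr, ofThreeBits, initPos]
  exact sum_products _ _ _ _ _ _

theorem thetaCircuit_prob (n : ℕ) (x x' : BitString n) (β : AngleBits n → Bool) :
    (thetaCircuit n).prob (Sum.elim x (Sum.elim x' β)) (theta n x x' β) = 1 := by
  set gs := ((List.finRange (n - 1)).flatMap (thetaTerms n)).flatMap mulAdder with hgs
  have hzero : (fun _ => false) = adderState 0 false := by decide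
  set out := adderState (thetaZMod n x x' (fun i j => β (Sum.inl (i, j)))
    (fun i => β (Sum.inr i))) false with hout
  have hact : actList gs (Sum.elim (Sum.elim (Sum.elim x x') β) fun _ => false) =
      Sum.elim (Sum.elim (Sum.elim x x') β) out := by
    rw [hzero, hgs, actList_mulAdders, thetaTerms_sum, zero_add]
  have hrun : ∀ v : (Fin n ⊕ Fin n ⊕ AngleBits n) ⊕ Fin 5 → Bool,
      run (gs.map (Gate.map (assocWires _ _ _ (Fin 5))))
        (basis (Sum.elim (Sum.elim x (Sum.elim x' β)) fun _ => false)) v =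
      basis (Sum.elim (Sum.elim x (Sum.elim x' β)) out) v := by
    intro v
    have key : ∀ a : Fin 5 → Bool, ∀ w : (Fin n ⊕ Fin n ⊕ AngleBits n) ⊕ Fin 5 → Bool,
        basis (Sum.elim (Sum.elim x (Sum.elim x' β)) a) w =
        basis (Sum.elim (Sum.elim (Sum.elim x x') β) a) (w ∘ assocWires _ _ _ (Fin 5)) := by
      intro a w
      refine basis_apply_of_iff ?_
      constructor
      · rintro rfl
        funext i
        rcases i with ((i | i) | i) | i <;> rfl
      · intro h
        funext i
        rcases i with (i | i | i) | i
        · exact congrFun h (Sum.inl (Sum.inl (Sum.inl i)))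
        · exact congrFun h (Sum.inl (Sum.inl (Sum.inr i)))
        · exact congrFun h (Sum.inl (Sum.inr i))
        · exact congrFun h (Sum.inr i)
    rw [run_map]
    have : (fun w => basis (Sum.elim (Sum.elim x (Sum.elim x' β)) fun _ => false)
        (Function.extend (assocWires _ _ _ (Fin 5)) w v)) =
        basis (Sum.elim (Sum.elim (Sum.elim x x') β) fun _ => false) := by
      funext w
      rw [key]
      congr 1
      funext i
      exact (assocWires _ _ _ (Fin 5)).injective.extend_apply _ _ i
    rw [this, run_basis _ (isClassical_mulAdders _), hact, key]
  rw [thetaCircuit, Circuit.prob_ofGates, ← hgs]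
  simp only [hrun]
  rw [Finset.sum_eq_single (Sum.elim (Sum.elim x (Sum.elim x' β)) out)]
  · rw [if_pos]
    · simp [basis]
    · funext j
      fin_cases j <;> rfl
  · intro v _ hv
    simp [basis, hv]
  · simp

theorem isQPT_thetaCircuit : IsQPT thetaCircuit := by
  -- At most 6n input wires and 80n gates (8 products per position, at most 10 gates each), with 5
  -- ancillas and 3 outputs.
  refine ⟨Polynomial.C 86 * Polynomial.X + Polynomial.C 8, fun n => ?_⟩
  have h := length_mulAdders_le ((List.finRange (n - 1)).flatMap (thetaTerms n))
  have h' : ((List.finRange (n - 1)).flatMap (thetaTerms n)).length = (n - 1) * 8 := by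
    simp [List.length_flatMap, thetaTerms]
  rw [thetaCircuit, Circuit.size_ofGates, List.length_map]
  simp only [Fintype.card_sum, Fintype.card_prod, Fintype.card_fin, Polynomial.eval_add,
    Polynomial.eval_mul, Polynomial.eval_C, Polynomial.eval_X]
  omega

end Theta

/-! ## Averages -/

section Average

variable {α β : Type} [Fintype α] [Fintype β]

theorem avg_const_mul (c : ℝ) (φ : α → ℝ) : (avg fun a => c * φ a) = c * avg φ := by
  rw [avg, avg, ← Finset.mul_sum, mul_div_assoc]

theorem avg_sum {ι : Type} (s : Finset ι) (φ : ι → α → ℝ) :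
    (avg fun a => ∑ i ∈ s, φ i a) = ∑ i ∈ s, avg (φ i) := by
  simp only [avg]
  rw [Finset.sum_comm, Finset.sum_div]

theorem avg_sub (φ ψ : α → ℝ) : (avg fun a => φ a - ψ a) = avg φ - avg ψ := by
  simp only [avg, Finset.sum_sub_distrib, sub_div]

theorem avg_const [Nonempty α] (c : ℝ) : (avg fun _ : α => c) = c := by
  simp [avg]

theorem avg_mono {φ ψ : α → ℝ} (h : ∀ a, φ a ≤ ψ a) : avg φ ≤ avg ψ :=
  div_le_div_of_nonneg_right (Finset.sum_le_sum fun a _ => h a) (Nat.cast_nonneg _)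

theorem avg_nonneg {φ : α → ℝ} (h : ∀ a, 0 ≤ φ a) : 0 ≤ avg φ :=
  div_nonneg (Finset.sum_nonneg fun a _ => h a) (Nat.cast_nonneg _)

theorem sq_avg_le (φ : α → ℝ) : avg φ ^ 2 ≤ avg fun a => φ a ^ 2 := by
  rw [avg, avg, div_pow]
  rcases Nat.eq_zero_or_pos (Fintype.card α) with h | h
  · simp [h]
  · have h' : (0 : ℝ) < Fintype.card α := by exact_mod_cast h
    have := sq_sum_le_card_mul_sum_sq (s := (Finset.univ : Finset α)) (f := φ)
    rw [Finset.card_univ] at this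
    rw [div_le_div_iff₀ (by positivity) h']
    nlinarith

theorem sum_extend (f : α ↪ β) [DecidableEq α] [DecidableEq β] (G : (β → Bool) → ℝ) :
    ∑ v, ∑ u : α → Bool, G (Function.extend f u v) = ∑ v, ∑ _u : α → Bool, G v := by
  rw [← Fintype.sum_prod_type' (f := fun v u => G (Function.extend f u v)),
    ← Fintype.sum_prod_type' (f := fun v (_ : α → Bool) => G v)]
  -- Exchanging the bits of `v` on the range of `f` with `u` permutes the pairs.
  have hσ : Function.Involutive fun p : (β → Bool) × (α → Bool) =>
      (Function.extend f p.2 p.1, p.1 ∘ f) := by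
    rintro ⟨v, u⟩
    refine Prod.ext ?_ ?_
    · change Function.extend f (v ∘ f) (Function.extend f u v) = v
      rw [extend_extend, extend_self_comp]
    · exact Function.extend_comp f.injective u v
  exact Fintype.sum_equiv hσ.toPerm _ _ fun p => rfl

/-- Resampling some bits of a uniform string leaves it uniform. This isolates the inner average over
one group of bits. -/
theorem avg_extend (f : α ↪ β) [DecidableEq α] [DecidableEq β] (G : (β → Bool) → ℝ) :
    (avg fun v => avg fun u : α → Bool => G (Function.extend f u v)) = avg G := by
  have h : (Fintype.card (α → Bool) : ℝ) ≠ 0 := by simp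
  simp only [avg, ← Finset.sum_div]
  rw [sum_extend]
  simp only [Finset.sum_const, Finset.card_univ, nsmul_eq_mul, ← Finset.mul_sum]
  rw [mul_div_cancel_left₀ _ h]

/-- Fixing the bits on the range of `g`, for functions which do not depend on them. -/
theorem sum_ite_extend (g : α ↪ β) [DecidableEq α] [DecidableEq β] (s : α → Bool)
    (Q : (β → Bool) → ℝ) (hQ : ∀ u v, Q (Function.extend g u v) = Q v) :
    (∑ v : β → Bool, if (fun a => v (g a)) = s then Q v else 0) =
      (1 / 2) ^ Fintype.card α * ∑ v, Q v := by
  have h := sum_extend g fun v => if (fun a => v (g a)) = s then Q v else 0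
  have h1 : ∀ (u : α → Bool) (v : β → Bool), (fun a => Function.extend g u v (g a)) = u :=
    fun u v => Function.extend_comp g.injective u v
  simp only [h1, hQ, Finset.sum_ite_eq', Finset.mem_univ, if_true,
    Finset.sum_const,
    Finset.card_univ, nsmul_eq_mul, ← Finset.mul_sum, Fintype.card_fun, Fintype.card_bool] at h
  rw [h]
  push_cast
  rw [← mul_assoc, ← mul_pow]
  norm_num

theorem sum_sum_arrow [DecidableEq α] [DecidableEq β] (G : (α ⊕ β → Bool) → ℝ) :
    ∑ v, G v = ∑ a, ∑ b, G (Sum.elim a b) := by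
  rw [← Fintype.sum_prod_type' (f := fun a b => G (Sum.elim a b))]
  exact Fintype.sum_equiv (Equiv.sumArrowEquivProdArrow α β Bool) _ _ fun v => by
    simp [Equiv.sumArrowEquivProdArrow]

end Average

/-! ## Characters -/

section Characters

variable {S : Type} [Fintype S] [DecidableEq S]

theorem sum_dotSign_mul_dotSign (t t' : S → Bool) :
    ∑ τ : S → Bool, dotSign τ t * dotSign τ t' = if t = t' then 2 ^ Fintype.card S else 0 := by
  have h : ∀ τ : S → Bool, dotSign τ t * dotSign τ t' =
      ∏ s, bitSign (τ s) (t s) * bitSign (τ s) (t' s) := fun τ => by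
    rw [dotSign, dotSign, Finset.prod_mul_distrib]
  have h1 : ∀ b b' : Bool, ∑ c : Bool, bitSign c b * bitSign c b' = if b = b' then 2 else 0 := by
    decide
  simp only [h]
  rw [← Fintype.piFinset_univ, ← Finset.prod_univ_sum (fun _ => Finset.univ)
    fun s c => bitSign c (t s) * bitSign c (t' s)]
  simp only [h1]
  by_cases ht : t = t'
  · simp [ht]
  · rw [if_neg ht]
    obtain ⟨s, hs⟩ := Function.ne_iff.mp ht
    exact Finset.prod_eq_zero (Finset.mem_univ s) (if_neg hs)

theorem fourier_inversion (D : (S → Bool) → ℝ) (t : S → Bool) :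
    D t = ∑ τ : S → Bool, (dotSign τ t : ℝ) * avg fun t' => (dotSign τ t' : ℝ) * D t' := by
  have h : ∀ t', ∑ τ : S → Bool, (dotSign τ t : ℝ) * (dotSign τ t' : ℝ) =
      if t = t' then 2 ^ Fintype.card S else 0 := by
    intro t'
    have := sum_dotSign_mul_dotSign t t'
    exact_mod_cast this
  simp only [avg, ← mul_div_assoc, Finset.mul_sum, ← Finset.sum_div]
  rw [Finset.sum_comm]
  simp only [← mul_assoc, ← Finset.sum_mul, h]
  simp

omit [DecidableEq S] in
theorem dotSign_sq (a b : S → Bool) : (dotSign a b : ℝ) ^ 2 = 1 := by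
  have h : ∀ a b, bitSign a b ^ 2 = 1 := by decide
  have : dotSign a b ^ 2 = 1 := by
    rw [dotSign, ← Finset.prod_pow]
    exact Finset.prod_eq_one fun s _ => h _ _
  exact_mod_cast this

end Characters

/-! ## `θ` as a function of one group of bits -/

section ThetaSign

/-- The sign `(-1) ^ m`. -/
def paritySign (m : ZMod 8) : ℤ := if m.val.testBit 0 then -1 else 1

theorem paritySign_add (a b : ZMod 8) : paritySign (a + b) = paritySign a * paritySign b := by
  revert a b; decide

theorem paritySign_sum {ι : Type} (s : Finset ι) (m : ι → ZMod 8) :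
    paritySign (∑ i ∈ s, m i) = ∏ i ∈ s, paritySign (m i) := by
  classical
  induction s using Finset.induction_on with
  | empty => simp [paritySign]
  | insert i s hi ih => rw [Finset.sum_insert hi, Finset.prod_insert hi, paritySign_add, ih]

/-- Modulo 2 the difference of two bits is their sum, so the order of the two preimages disappears
here. -/
theorem paritySign_sub_mul (a b w : Bool) :
    paritySign (((a.toNat : ZMod 8) - (b.toNat : ZMod 8)) * (w.toNat : ZMod 8)) =
      bitSign (xor a b) w := by
  revert a b w; decide

/-- `v` is the most significant position of `τ`. -/
def IsLeading (τ : BitString 3) (v : Fin 3) : Prop := τ v = true ∧ ∀ j < v, τ j = false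

theorem exists_isLeading (τ : BitString 3) (hτ : τ ≠ fun _ => false) : ∃ v, IsLeading τ v := by
  revert τ
  unfold IsLeading
  decide

/-- The weight of the bit in position `v`. -/
def bitWeight (v : Fin 3) : ZMod 8 := 2 ^ (2 - v.val)

theorem ofThreeBits_update (a : BitString 3) (v : Fin 3) (w : Bool) :
    ofThreeBits (Function.update a v w) =
      ofThreeBits (Function.update a v false) + bitWeight v * (w.toNat : ZMod 8) := by
  fin_cases v <;> simp [ofThreeBits, bitWeight] <;> ring

/-- Adding a multiple of 2^(2-v) fixes the bits less significant than position `v`, flips bit `v` by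
the parity of `m`, and sends carries only to more significant bits, where the character is trivial.
-/
theorem dotSign_toThreeBits_add (a b c : Bool) (v : Fin 3) (h : IsLeading ![a, b, c] v)
    (z m : ZMod 8) : dotSign ![a, b, c] (toThreeBits (z + bitWeight v * m)) =
      dotSign ![a, b, c] (toThreeBits z) * paritySign m := by
  revert a b c v z m
  unfold IsLeading
  simp only [dotSign, Fin.prod_univ_three]
  decide

/-- The bits in position `v` of the `α_i`. -/
def angleGroup (n : ℕ) (v : Fin 3) : Fin (n - 1) ↪ AngleBits n where
  toFun i := Sum.inl (i, v)
  inj' := by intro i i' h; simpa using h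

theorem thetaZMod_extend (n : ℕ) (x x' : BitString n) (v : Fin 3) (w : Fin (n - 1) → Bool)
    (β : AngleBits n → Bool) :
    thetaZMod n x x' (fun i j => Function.extend (angleGroup n v) w β (Sum.inl (i, j)))
      (fun i => Function.extend (angleGroup n v) w β (Sum.inr i)) =
    thetaZMod n x x' (fun i => Function.update (fun j => β (Sum.inl (i, j))) v false)
      (fun i => β (Sum.inr i)) + bitWeight v * ∑ i : Fin (n - 1),
        ((((x (initPos n i)).toNat : ZMod 8) - ((x' (initPos n i)).toNat : ZMod 8)) *
          ((w i).toNat : ZMod 8)) := by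
  have h1 : ∀ i, (fun j => Function.extend (angleGroup n v) w β (Sum.inl (i, j))) =
      Function.update (fun j => β (Sum.inl (i, j))) v (w i) := by
    intro i
    funext j
    by_cases hj : j = v
    · subst hj
      rw [Function.update_self]
      exact (angleGroup n j).injective.extend_apply w β i
    · rw [Function.update_of_ne hj, Function.extend_apply']
      rintro ⟨a, ha⟩
      have h := Sum.inl.inj (show (Sum.inl (a, v) : AngleBits n) = Sum.inl (i, j) from ha)
      exact hj (Prod.ext_iff.mp h).2.symm
  have h2 : ∀ i, Function.extend (angleGroup n v) w β (Sum.inr i) = β (Sum.inr i) := by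
    intro i
    rw [Function.extend_apply']
    rintro ⟨a, ha⟩
    simp [angleGroup] at ha
  simp only [thetaZMod, h1, h2]
  rw [Finset.mul_sum, ← Finset.sum_add_distrib]
  refine Finset.sum_congr rfl fun i _ => ?_
  rw [ofThreeBits_update]
  simp only [initPos]
  ring

/-- The heart of the argument: for the group matching the leading bit of `τ`, the sign of θ is
linear in that group. The first factor has the group set to zero, so it does not depend on `w`. -/
theorem dotSign_theta_extend (n : ℕ) (x x' : BitString n) (τ : BitString 3) (v : Fin 3)
    (hv : IsLeading τ v) (w : Fin (n - 1) → Bool) (β : AngleBits n → Bool) :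
    dotSign τ (theta n x x' (Function.extend (angleGroup n v) w β)) =
      dotSign τ (toThreeBits (thetaZMod n x x'
        (fun i => Function.update (fun j => β (Sum.inl (i, j))) v false)
        (fun i => β (Sum.inr i)))) *
      dotSign (fun i => xor (x (initPos n i)) (x' (initPos n i))) w := by
  obtain ⟨a, b, c, rfl⟩ : ∃ a b c, τ = ![a, b, c] := ⟨τ 0, τ 1, τ 2, by
    funext i; fin_cases i <;> rfl⟩
  rw [theta, thetaZMod_extend, dotSign_toThreeBits_add a b c v hv, paritySign_sum]
  simp only [paritySign_sub_mul]
  rfl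

/-- The correlation of `D`, for given values of the other bits, with a character of the bits in
group `v` and of the last argument. -/
noncomputable def groupCorr (n : ℕ) (v : Fin 3) (s : Fin (n - 1) → Bool)
    (D : (AngleBits n → Bool) → BitString 3 → ℝ) (τ : BitString 3) (β : AngleBits n → Bool) : ℝ :=
  avg fun w => (dotSign s w : ℝ) *
    avg fun t => (dotSign τ t : ℝ) * D (Function.extend (angleGroup n v) w β) t

theorem sq_avg_dotSign_theta_le (n : ℕ) (x x' : BitString n)
    (D : (AngleBits n → Bool) → BitString 3 → ℝ) (τ : BitString 3) (v : Fin 3)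
    (hv : IsLeading τ v) :
    (avg fun β => (dotSign τ (theta n x x' β) : ℝ) * avg fun t => (dotSign τ t : ℝ) * D β t) ^ 2 ≤
      avg fun β => groupCorr n v (fun i => xor (x (initPos n i)) (x' (initPos n i))) D τ β ^ 2 := by
  rw [← avg_extend (angleGroup n v)]
  refine (sq_avg_le _).trans (avg_mono fun β => le_of_eq ?_)
  simp only [dotSign_theta_extend n x x' τ v hv]
  push_cast
  simp only [mul_assoc]
  -- The sign independent of `w` leaves the inner average and disappears on squaring.
  rw [avg_const_mul, mul_pow, dotSign_sq, one_mul]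
  rfl

/-- The advantage of a distinguisher is bounded by its correlations with characters of the groups
of bits. -/
theorem sq_advantage_le (n : ℕ) (x x' : BitString n)
    (D : (AngleBits n → Bool) → BitString 3 → ℝ) :
    ((avg fun β => D β (theta n x x' β)) - avg fun β => avg fun t => D β t) ^ 2 ≤
      8 * ∑ v : Fin 3, avg fun β => ∑ τ : BitString 3,
        groupCorr n v (fun i => xor (x (initPos n i)) (x' (initPos n i))) D τ β ^ 2 := by
  set s : Fin (n - 1) → Bool := fun i => xor (x (initPos n i)) (x' (initPos n i)) with hs
  set X : BitString 3 → ℝ := fun τ =>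
    avg fun β => (dotSign τ (theta n x x' β) : ℝ) * avg fun t => (dotSign τ t : ℝ) * D β t with hX
  have h1 : (avg fun β => D β (theta n x x' β)) = ∑ τ, X τ := by
    rw [hX, ← avg_sum]
    congr 1
    funext β
    exact fourier_inversion (D β) _
  -- The trivial character ignores θ, so its term is exactly the uniform case and cancels in the
  -- advantage.
  have h0 : X (fun _ => false) = avg fun β => avg fun t => D β t := by
    simp [hX, dotSign, bitSign]
  have h2 : (avg fun β => D β (theta n x x' β)) - (avg fun β => avg fun t => D β t) =
      ∑ τ ∈ Finset.univ.erase (fun _ => false), X τ := by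
    rw [h1, ← h0, ← Finset.add_sum_erase _ _ (Finset.mem_univ fun _ => false)]
    ring
  rw [h2]
  refine sq_sum_le_card_mul_sum_sq.trans ?_
  have hcard : (((Finset.univ : Finset (BitString 3)).erase fun _ => false).card : ℝ) ≤ 8 := by
    have : ((Finset.univ : Finset (BitString 3)).erase fun _ => false).card ≤ 8 :=
      (Finset.card_erase_le).trans (by simp)
    exact_mod_cast this
  refine mul_le_mul hcard ?_ (Finset.sum_nonneg fun _ _ => sq_nonneg _) (by norm_num)
  simp only [avg_sum]
  rw [Finset.sum_comm]
  -- Each nonzero `τ` needs only its own leading `v`. Summing over all pairs is harmless and matches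
  -- the finder, whose measured `τ` is unrestricted.
  refine (Finset.sum_le_sum fun τ hτ => ?_).trans (Finset.sum_le_sum_of_subset_of_nonneg
    (Finset.erase_subset _ _) fun τ _ _ => Finset.sum_nonneg fun v _ =>
      avg_nonneg fun β => sq_nonneg _)
  obtain ⟨v, hv⟩ := exists_isLeading τ (Finset.ne_of_mem_erase hτ)
  refine (sq_avg_dotSign_theta_le n x x' D τ v hv).trans ?_
  exact Finset.single_le_sum
    (f := fun v => avg fun β => groupCorr n v s D τ β ^ 2)
    (fun v _ => avg_nonneg fun β => sq_nonneg _) (Finset.mem_univ v)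

end ThetaSign

/-! ## The second-preimage finder -/

section Finder

variable {n K M : ℕ}

/-- The random bits of the finder: `β`, the guess of `θ`, and a coin for the last position. -/
abbrev FinderBits (n : ℕ) : Type := (AngleBits n ⊕ Fin 3) ⊕ Unit

/-- The origin of the inputs of the distinguisher. -/
def finderSource (n K M : ℕ) :
    Fin K ⊕ Fin M ⊕ AngleBits n ⊕ Fin 3 → ((Fin K ⊕ Fin n) ⊕ Fin M) ⊕ FinderBits n :=
  Sum.elim (fun k => Sum.inl (Sum.inl (Sum.inl k)))
    (Sum.elim (fun m => Sum.inl (Sum.inr m)) fun r => Sum.inr (Sum.inl r))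

/-- The bits on which the finder applies Hadamard gates after the query. -/
def finderGroup (n : ℕ) (v : Fin 3) : Fin (n - 1) ⊕ Fin 3 ↪ FinderBits n where
  toFun := fun i => Sum.inl (Sum.map (angleGroup n v) id i)
  inj' := by
    intro i i' h
    exact Function.Injective.sumMap (angleGroup n v).injective Function.injective_id
      (Sum.inl.inj h)

/-- The bits which the finder adds to `x`. -/
def finderOutput (n : ℕ) (v : Fin 3) : Fin n ↪ FinderBits n where
  toFun := fun i => if h : i.val < n - 1 then Sum.inl (Sum.inl (Sum.inl (⟨i, h⟩, v))) else
    Sum.inr ()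
  inj' := by
    intro i i' h
    have hi := i.isLt
    have hi' := i'.isLt
    apply Fin.ext
    by_cases h1 : i.val < n - 1 <;> by_cases h2 : i'.val < n - 1 <;> simp [h1, h2] at h
    · exact h
    · omega

theorem finderOutput_apply (v : Fin 3) (i : Fin n) : finderOutput n v i =
    if h : i.val < n - 1 then Sum.inl (Sum.inl (Sum.inl (⟨i, h⟩, v))) else Sum.inr () := rfl

theorem finderOutput_initPos (v : Fin 3) (i : Fin (n - 1)) :
    finderOutput n v (initPos n i) = Sum.inl (Sum.inl (angleGroup n v i)) := by
  have : (initPos n i).val < n - 1 := i.isLt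
  rw [finderOutput_apply, dif_pos this]
  rfl

/-- The circuit which, given `k`, `x` and `f_k(x)`, uses a distinguisher to find a second
preimage. -/
noncomputable def imageFinder (v : Fin 3)
    (A : Circuit (Fin K ⊕ Fin M ⊕ AngleBits n ⊕ Fin 3) (Fin 1)) :
    Circuit ((Fin K ⊕ Fin n) ⊕ Fin M) (Fin n) :=
  extraction A (finderSource n K M) (finderGroup n v) (finderOutput n v)
    fun i => Sum.inl (Sum.inr i)

theorem dotSign_elim {S T : Type} [Fintype S] [Fintype T] (a b : S → Bool) (c d : T → Bool) :
    dotSign (Sum.elim a c) (Sum.elim b d) = dotSign a b * dotSign c d := by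
  simp [dotSign]

theorem extend_finderGroup (v : Fin 3) (w : Fin (n - 1) → Bool) (t τ : BitString 3)
    (β : AngleBits n → Bool) (c : Unit → Bool) :
    Function.extend (finderGroup n v) (Sum.elim w t) (Sum.elim (Sum.elim β τ) c) =
      Sum.elim (Sum.elim (Function.extend (angleGroup n v) w β) t) c := by
  funext i
  rcases i with (i | i) | i
  · by_cases hi : ∃ a, angleGroup n v a = i
    · obtain ⟨a, rfl⟩ := hi
      refine ((finderGroup n v).injective.extend_apply _ _ (Sum.inl a)).trans ?_
      exact ((angleGroup n v).injective.extend_apply w β a).symm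
    · rw [Function.extend_apply']
      · exact (Function.extend_apply' w β i hi).symm
      · rintro ⟨a | a, ha⟩
        · exact hi ⟨a, Sum.inl.inj (Sum.inl.inj ha)⟩
        · cases Sum.inl.inj ha
  · exact (finderGroup n v).injective.extend_apply _ _ (Sum.inr i)
  · rw [Function.extend_apply']
    · rfl
    · rintro ⟨a, ha⟩
      cases ha

/-- The bits of `β` outside group `v` are not changed by fixing the output bits of the finder. -/
theorem extend_extend_finderOutput (v : Fin 3) (w : Fin (n - 1) → Bool) (u : BitString n)
    (ρ : FinderBits n → Bool) :
    Function.extend (angleGroup n v) w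
      (fun b => Function.extend (finderOutput n v) u ρ (Sum.inl (Sum.inl b))) =
    Function.extend (angleGroup n v) w (fun b => ρ (Sum.inl (Sum.inl b))) := by
  funext b
  by_cases hb : ∃ a, angleGroup n v a = b
  · obtain ⟨a, rfl⟩ := hb
    rw [(angleGroup n v).injective.extend_apply, (angleGroup n v).injective.extend_apply]
  · rw [Function.extend_apply' _ _ _ hb, Function.extend_apply' _ _ _ hb, Function.extend_apply']
    rintro ⟨i, hi⟩
    by_cases h : i.val < n - 1
    · refine hb ⟨⟨i, h⟩, ?_⟩
      have := finderOutput_initPos v ⟨i, h⟩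
      exact Sum.inl.inj (Sum.inl.inj (this.symm.trans hi))
    · simp [finderOutput_apply, h] at hi

/-- Measuring `s` on group `v` gives `x'` on the first n-1 positions, for every value of the
measured `τ`; the factor 1/2 is the chance that the coin gives the last bit. -/
theorem le_prob_imageFinder (hn : 1 ≤ n) (v : Fin 3)
    (A : Circuit (Fin K ⊕ Fin M ⊕ AngleBits n ⊕ Fin 3) (Fin 1)) (k : BitString K)
    (x x' : BitString n) (y : BitString M) :
    1 / 2 * (avg fun β => ∑ τ : BitString 3,
      groupCorr n v (fun i => xor (x' (initPos n i)) (x (initPos n i)))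
        (fun β t => A.bias (Sum.elim k (Sum.elim y (Sum.elim β t)))) τ β ^ 2) ≤
      (imageFinder v A).prob (Sum.elim (Sum.elim k x) y) x' := by
  set s : Fin (n - 1) → Bool := fun i => xor (x' (initPos n i)) (x (initPos n i)) with hs
  set D : (AngleBits n → Bool) → BitString 3 → ℝ :=
    fun β t => A.bias (Sum.elim k (Sum.elim y (Sum.elim β t))) with hD
  refine le_trans (le_of_eq ?_) (le_prob_extraction A (finderSource n K M) (finderGroup n v)
    (finderOutput n v) (fun i => Sum.inl (Sum.inr i)) (Sum.elim (Sum.elim k x) y) x')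
  set q : (AngleBits n → Bool) → BitString 3 → ℝ := fun β τ =>
    (∑ w : Fin (n - 1) → Bool, ∑ t : BitString 3, (dotSign s w : ℝ) * ((dotSign τ t : ℝ) *
      D (Function.extend (angleGroup n v) w β) t)) ^ 2 with hq
  have hsrc : ∀ (β : AngleBits n → Bool) (t : BitString 3) (c : Unit → Bool),
      (fun j => Sum.elim (Sum.elim (Sum.elim k x) y) (Sum.elim (Sum.elim β t) c)
        (finderSource n K M j)) = Sum.elim k (Sum.elim y (Sum.elim β t)) := by
    intro β t c
    funext j
    rcases j with j | j | j | j <;> rfl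
  have hsum : ∀ ρ : FinderBits n → Bool, (if (fun o => ρ (finderOutput n v o)) =
      (fun o => xor (x' o) (Sum.elim (Sum.elim k x) y (Sum.inl (Sum.inr o)))) then
        (∑ u : Fin (n - 1) ⊕ Fin 3 → Bool, (dotSign (ρ ∘ finderGroup n v) u : ℝ) *
          A.bias fun j => Sum.elim (Sum.elim (Sum.elim k x) y)
            (Function.extend (finderGroup n v) u ρ) (finderSource n K M j)) ^ 2 else 0) =
      if (fun o => ρ (finderOutput n v o)) = (fun o => xor (x' o) (x o)) then
        q (fun b => ρ (Sum.inl (Sum.inl b))) (fun t => ρ (Sum.inl (Sum.inr t))) else 0 := by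
    intro ρ
    by_cases hρ : (fun o => ρ (finderOutput n v o)) = fun o => xor (x' o) (x o)
    · refine (if_pos hρ).trans (Eq.trans ?_ (if_pos hρ).symm)
      rw [sum_sum_arrow]
      refine congrArg (· ^ 2) ?_
      refine Finset.sum_congr rfl fun w _ => Finset.sum_congr rfl fun t _ => ?_
      obtain ⟨β, τ, c, rfl⟩ : ∃ β τ c, ρ = Sum.elim (Sum.elim β τ) c :=
        ⟨fun b => ρ (Sum.inl (Sum.inl b)), fun t => ρ (Sum.inl (Sum.inr t)),
          fun c => ρ (Sum.inr c), by funext i; rcases i with (i | i) | i <;> rfl⟩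
      -- Outputting `x'` forces the measured bits of group `v` to equal `s`; the bits holding the
      -- guess of θ stay free and play the role of `τ`.
      have hgroup : Sum.elim (Sum.elim β τ) c ∘ finderGroup n v = Sum.elim s τ := by
        funext i
        rcases i with i | i
        · have := congrFun hρ (initPos n i)
          rw [finderOutput_initPos] at this
          exact this
        · rfl
      rw [hgroup, extend_finderGroup, hsrc, dotSign_elim]
      push_cast
      rw [mul_assoc]
      rfl
    · exact (if_neg hρ).trans (if_neg hρ).symm
  simp only [hsum]
  -- Once group `v` is fixed to `s`, the correlation depends only on the remaining bits of β and on
  -- `τ`, so the restriction merely costs the factor 2^(-n).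
  rw [sum_ite_extend (finderOutput n v) (fun o => xor (x' o) (x o))
    (fun ρ => q (fun b => ρ (Sum.inl (Sum.inl b))) (fun t => ρ (Sum.inl (Sum.inr t))))]
  · rw [sum_sum_arrow, sum_sum_arrow]
    simp only [Sum.elim_inl, Sum.elim_inr, Finset.sum_const, Finset.card_univ, nsmul_eq_mul,
      Fintype.card_fun, Fintype.card_bool, Fintype.card_unit, groupCorr, avg, Fintype.card_sum,
      Fintype.card_fin, ← Finset.mul_sum]
    have hpow : ∀ β τ, ((∑ w : Fin (n - 1) → Bool, (dotSign s w : ℝ) *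
        ((∑ t : BitString 3, (dotSign τ t : ℝ) * D (Function.extend (angleGroup n v) w β) t) /
          ((2 ^ 3 : ℕ) : ℝ))) / ((2 ^ (n - 1) : ℕ) : ℝ)) ^ 2 =
        q β τ / (2 ^ 3 * 2 ^ (n - 1)) ^ 2 := by
      intro β τ
      rw [hq]
      simp only [← mul_div_assoc, ← Finset.sum_div, Finset.mul_sum]
      rw [div_div, div_pow]
      push_cast
      norm_num
    simp only [hpow, ← Finset.sum_div]
    -- The powers of two balance only when n = (n - 1) + 1, which is where `hn` is needed.
    obtain ⟨m, rfl⟩ : ∃ m, n = m + 1 := ⟨n - 1, by omega⟩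
    simp only [Nat.add_sub_cancel]
    push_cast
    simp only [pow_add, one_div, inv_pow]
    field_simp
  · intro u ρ
    have h : ∀ t, Function.extend (finderOutput n v) u ρ (Sum.inl (Sum.inr t)) =
        ρ (Sum.inl (Sum.inr t)) := by
      intro t
      rw [Function.extend_apply']
      rintro ⟨i, hi⟩
      by_cases h : i.val < n - 1 <;> simp [finderOutput_apply, h] at hi
    simp only [hq, extend_extend_finderOutput, h]

/-- The second-preimage finder. -/
noncomputable def finder (v : Fin 3) (C : Circuit (Fin K ⊕ Fin n) (Fin M))
    (A : Circuit (Fin K ⊕ Fin M ⊕ AngleBits n ⊕ Fin 3) (Fin 1)) :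
    Circuit (Fin K ⊕ Fin n) (Fin n) :=
  compCircuit C (imageFinder v A)

theorem size_finder_le (v : Fin 3) (C : Circuit (Fin K ⊕ Fin n) (Fin M))
    (A : Circuit (Fin K ⊕ Fin M ⊕ AngleBits n ⊕ Fin 3) (Fin 1)) :
    (finder v C A).size ≤ 5 * C.size + 6 * A.size + 6 * n + 20 := by
  have h := size_extraction A (finderSource n K M) (finderGroup n v) (finderOutput n v)
    fun i => Sum.inl (Sum.inr i)
  rw [finder, size_compCircuit]
  change (imageFinder v A).size = _ at h
  rw [Circuit.size] at h
  simp only [Circuit.size]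
  simp only [Fintype.card_sum, Fintype.card_fin, Fintype.card_unit] at h ⊢
  omega

end Finder

/-! ## Expectations over the index, and negligible functions -/

namespace FunctionFamily

variable (F : FunctionFamily) (n : ℕ)

theorem sum_toReal_gen : ∑ k, (F.gen n k).toReal = 1 := by
  rw [← ENNReal.toReal_sum fun k _ => (F.gen n).apply_ne_top k,
    ← tsum_fintype (L := .unconditional _),
    (F.gen n).tsum_coe, ENNReal.toReal_one]

theorem sq_expectKey_le (φ : BitString (F.keyLen n) → ℝ) :
    F.expectKey n φ ^ 2 ≤ F.expectKey n fun k => φ k ^ 2 :=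
  Real.pow_arith_mean_le_arith_mean_pow_of_even _ _ _ (fun _ _ => ENNReal.toReal_nonneg)
    (F.sum_toReal_gen n) even_two

theorem expectKey_mono {φ ψ : BitString (F.keyLen n) → ℝ}
    (h : ∀ k ∈ (F.gen n).support, φ k ≤ ψ k) : F.expectKey n φ ≤ F.expectKey n ψ := by
  refine Finset.sum_le_sum fun k _ => ?_
  by_cases hk : k ∈ (F.gen n).support
  · exact mul_le_mul_of_nonneg_left (h k hk) ENNReal.toReal_nonneg
  · rw [PMF.mem_support_iff, not_not] at hk
    simp [hk]

theorem expectKey_sub (φ ψ : BitString (F.keyLen n) → ℝ) :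
    F.expectKey n φ - F.expectKey n ψ = F.expectKey n fun k => φ k - ψ k := by
  simp only [expectKey, mul_sub, Finset.sum_sub_distrib]

theorem expectKey_const_mul (c : ℝ) (φ : BitString (F.keyLen n) → ℝ) :
    (F.expectKey n fun k => c * φ k) = c * F.expectKey n φ := by
  simp only [expectKey, Finset.mul_sum]
  exact Finset.sum_congr rfl fun k _ => by ring

theorem expectKey_sum {ι : Type} (s : Finset ι) (φ : ι → BitString (F.keyLen n) → ℝ) :
    (F.expectKey n fun k => ∑ i ∈ s, φ i k) = ∑ i ∈ s, F.expectKey n (φ i) := by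
  simp only [expectKey, Finset.mul_sum]
  exact Finset.sum_comm

end FunctionFamily

theorem Negligible.sum {ι : Type} (s : Finset ι) (ε : ι → ℕ → ℝ)
    (h : ∀ i ∈ s, Negligible (ε i)) : Negligible fun n => ∑ i ∈ s, ε i n := by
  intro c
  simp only [Finset.mul_sum]
  simpa using tendsto_finsetSum s fun i hi => h i hi c

/-- A square root halves the polynomial exponent, so decay of `ε` against n^(2c) gives decay of `δ`
against n^c. -/
theorem negligible_of_sq_le {δ ε : ℕ → ℝ} (hε : Negligible ε)
    (h : ∀ᶠ n in Filter.atTop, δ n ^ 2 ≤ ε n) : Negligible fun n => |δ n| := by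
  intro c
  have h1 : Filter.Tendsto (fun n : ℕ => Real.sqrt ((n : ℝ) ^ (2 * c) * ε n)) Filter.atTop
      (nhds 0) := by
    have := (hε (2 * c)).sqrt
    rwa [Real.sqrt_zero] at this
  refine squeeze_zero' (Filter.Eventually.of_forall fun n => by positivity) ?_ h1
  filter_upwards [h] with n hn
  refine Real.le_sqrt_of_sq_le ?_
  rw [mul_pow, sq_abs, ← pow_mul, mul_comm c 2]
  exact mul_le_mul_of_nonneg_left hn (by positivity)

/-! ## Hard-core property -/

namespace FunctionFamily

variable (F : FunctionFamily)

theorem isQPT_finder (v : Fin 3)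
    {C : ∀ n, Circuit (Fin (F.keyLen n) ⊕ Fin n) (Fin (F.outLen n))} (hC : IsQPT C)
    {A : ∀ n, Circuit (Fin (F.keyLen n) ⊕ Fin (F.outLen n) ⊕ AngleBits n ⊕ Fin 3) (Fin 1)}
    (hA : IsQPT A) : IsQPT fun n => finder v (C n) (A n) := by
  obtain ⟨p, hp⟩ := hC
  obtain ⟨q, hq⟩ := hA
  refine ⟨5 * p + 6 * q + 6 * Polynomial.X + 20, fun n => ?_⟩
  have h1 := hp n
  have h2 := hq n
  have h3 := size_finder_le v (C n) (A n)
  simp only [Polynomial.eval_add, Polynomial.eval_mul, Polynomial.eval_X, Polynomial.eval_ofNat]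
  omega

theorem eq_or_eq_of_preimages (hreg : F.TwoRegular) {n : ℕ} (hn : 1 ≤ n)
    {k : BitString (F.keyLen n)} (hk : k ∈ (F.gen n).support) {x x₁ x₂ : BitString n}
    (hne : x₁ ≠ x₂) (h₁ : F.f n k x₁ = F.f n k x) (h₂ : F.f n k x₂ = F.f n k x) :
    x = x₁ ∨ x = x₂ := by
  have hcard := hreg n hn k hk (F.f n k x) ⟨x, rfl⟩
  have hsub : ({x₁, x₂} : Set (BitString n)) ⊆ F.f n k ⁻¹' {F.f n k x} := by
    rintro z (rfl | rfl)
    · exact h₁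
    · exact h₂
  -- Two distinct preimages exhaust a fibre of size two; this is how two-regularity enters.
  have heq := Set.eq_of_subset_of_ncard_le hsub (by rw [hcard, Set.ncard_pair hne])
  have : x ∈ F.f n k ⁻¹' {F.f n k x} := rfl
  rw [← heq] at this
  exact this

/-- For a fixed index and a fixed `x`, a distinguisher of `θ` yields second-preimage finders. -/
theorem sq_advantage_le_finder (hreg : F.TwoRegular) {n : ℕ} (hn : 1 ≤ n)
    {k : BitString (F.keyLen n)} (hk : k ∈ (F.gen n).support) (x x₁ x₂ : BitString n)
    (hne : x₁ ≠ x₂) (h₁ : F.f n k x₁ = F.f n k x) (h₂ : F.f n k x₂ = F.f n k x)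
    (C : Circuit (Fin (F.keyLen n) ⊕ Fin n) (Fin (F.outLen n)))
    (hC : C.prob (Sum.elim k x) (F.f n k x) = 1)
    (A : Circuit (Fin (F.keyLen n) ⊕ Fin (F.outLen n) ⊕ AngleBits n ⊕ Fin 3) (Fin 1)) :
    ((avg fun β : AngleBits n → Bool => A.prob (Sum.elim k (Sum.elim (F.f n k x)
      (Sum.elim β (theta n x₁ x₂ β)))) fun _ => true) -
      avg fun β : AngleBits n → Bool => avg fun r : BitString 3 =>
        A.prob (Sum.elim k (Sum.elim (F.f n k x) (Sum.elim β r))) fun _ => true) ^ 2 ≤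
    4 * ∑ v : Fin 3, ∑ x' : BitString n, if x' ≠ x ∧ F.f n k x' = F.f n k x then
      (finder v C A).prob (Sum.elim k x) x' else 0 := by
  set y := F.f n k x with hy
  have hbias := sq_advantage_le n x₁ x₂ fun β t => A.bias (Sum.elim k (Sum.elim y (Sum.elim β t)))
  -- `x` is one of the listed preimages and `x'` is the other; their sum is the same in either
  -- order.
  obtain ⟨x', hx', hfx', hs⟩ : ∃ x', x' ≠ x ∧ F.f n k x' = y ∧
      (fun i => xor (x₁ (initPos n i)) (x₂ (initPos n i))) =
        fun i => xor (x' (initPos n i)) (x (initPos n i)) := by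
    rcases F.eq_or_eq_of_preimages hreg hn hk hne h₁ h₂ with rfl | rfl
    · exact ⟨x₂, hne.symm, h₂, funext fun i => Bool.xor_comm _ _⟩
    · exact ⟨x₁, hne, h₁, rfl⟩
  rw [hs] at hbias
  simp only [Circuit.bias_eq _ (Sum.elim k (Sum.elim y (Sum.elim _ _)))] at hbias
  simp only [avg_sub, avg_const_mul, avg_const] at hbias
  have hv : ∀ v : Fin 3, 1 / 2 * (avg fun β => ∑ τ : BitString 3,
      groupCorr n v (fun i => xor (x' (initPos n i)) (x (initPos n i)))
        (fun β t => 1 - 2 * A.prob (Sum.elim k (Sum.elim y (Sum.elim β t))) fun _ => true) τ β ^ 2) ≤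
      ∑ x' : BitString n, if x' ≠ x ∧ F.f n k x' = y then
        (finder v C A).prob (Sum.elim k x) x' else 0 := by
    intro v
    have h := le_prob_imageFinder hn v A k x x' y
    simp only [Circuit.bias_eq _ (Sum.elim k (Sum.elim y (Sum.elim _ _)))] at h
    refine h.trans ((prob_le_prob_compCircuit C (imageFinder v A) (Sum.elim k x) y hC x').trans ?_)
    refine le_trans (le_of_eq ?_) (Finset.single_le_sum (f := fun x' : BitString n =>
      if x' ≠ x ∧ F.f n k x' = y then (finder v C A).prob (Sum.elim k x) x' else 0)
      (fun z _ => ?_) (Finset.mem_univ x'))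
    · simp only [if_pos (And.intro hx' hfx')]
      rfl
    · split_ifs
      · exact Circuit.prob_nonneg _ _ _
      · exact le_rfl
  have hsum := Finset.sum_le_sum fun v (_ : v ∈ (Finset.univ : Finset (Fin 3))) => hv v
  rw [← Finset.mul_sum] at hsum
  -- The bias is 1 - 2p, so `hbias` bounds 4 times the squared advantage by 8 times the
  -- correlations; the factor 1/2 in `hsum` then gives the constant 8 · 2 / 4 = 4.
  nlinarith [hbias, hsum]

/-- The bound for fixed `k` and `x` is already quadratic, so convexity of the square, applied to the
averages over `k` and over `x`, suffices; no set of good inputs has to be singled out. -/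
theorem sq_realProb_sub_randomProb_le (hreg : F.TwoRegular) {n : ℕ} (hn : 1 ≤ n)
    (C : Circuit (Fin (F.keyLen n) ⊕ Fin n) (Fin (F.outLen n)))
    (hC : ∀ k ∈ (F.gen n).support, ∀ x : BitString n, C.prob (Sum.elim k x) (F.f n k x) = 1)
    (pre : ∀ n, BitString (F.keyLen n) → BitString n → BitString n × BitString n)
    (hpre : F.IsPreimagePair pre)
    (A : Circuit (Fin (F.keyLen n) ⊕ Fin (F.outLen n) ⊕ AngleBits n ⊕ Fin 3) (Fin 1)) :
    (F.realProb n (theta n) (pre n) A - F.randomProb n A) ^ 2 ≤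
      4 * ∑ v : Fin 3, F.secondPreimageProb n (finder v C A) := by
  have hrhs : 4 * ∑ v : Fin 3, F.secondPreimageProb n (finder v C A) =
      F.expectKey n fun k => avg fun x : BitString n => 4 * ∑ v : Fin 3, ∑ x' : BitString n,
        if x' ≠ x ∧ F.f n k x' = F.f n k x then
          (finder v C A).prob (Sum.elim k x) x' else 0 := by
    simp only [avg_const_mul, avg_sum _ (fun (v : Fin 3) (x : BitString n) => _),
      expectKey_const_mul, secondPreimageProb]
    rw [expectKey_sum]
  rw [hrhs, realProb, randomProb, expectKey_sub]
  refine (F.sq_expectKey_le n _).trans (F.expectKey_mono n fun k hk => ?_)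
  rw [← avg_sub]
  refine (sq_avg_le _).trans (avg_mono fun x => ?_)
  obtain ⟨hne, h₁, h₂⟩ := hpre n hn k hk x
  exact F.sq_advantage_le_finder hreg hn hk x _ _ hne h₁ h₂ C (hC k hk x) A

end FunctionFamily

end QFactory

theorem theorem5p2 (F : QFactory.FunctionFamily) (hreg : F.TwoRegular)
    (hspr : F.SecondPreimageResistant) : F.IsHardcore QFactory.theta := by
  refine ⟨⟨QFactory.thetaCircuit, QFactory.isQPT_thetaCircuit, QFactory.thetaCircuit_prob⟩, ?_⟩
  intro pre hpre A hA
  obtain ⟨⟨C, hCQ, hC⟩, hres⟩ := hspr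
  have hsum := QFactory.Negligible.sum Finset.univ _ fun (v : Fin 3) _ =>
    hres (fun n => QFactory.finder v (C n) (A n)) (F.isQPT_finder v hCQ hA)
  refine QFactory.negligible_of_sq_le (Asymptotics.SuperpolynomialDecay.const_mul hsum 4) ?_
  filter_upwards [Filter.eventually_ge_atTop 1] with n hn
  exact F.sq_realProb_sub_randomProb_le hreg hn (C n) (hC n hn) pre hpre (A n)
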